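/- **Setting.** Let $n\ge 2$ and $d\ge 1$ be integers and $[n]=\{1,\dots,n\}$ a set of experts. In the partial information model, a prior $\mathcal D$ is a family of laws on $\mathbb R$, one for each $T\subseteq[n]$, of independent, mean-zero, square-integrable signals $X_T$, with $X_\emptyset=0$ almost surely and $\operatorname{Var}(X_T)>0$ for some $T$. Expert $i$ observes $\mathcal S_i=\{X_T: i\in T\}$, and the quantity to be estimated is $Y=\sum_T X_T$. A query $Q$ put to an expert $i=\mathsf{agent}(Q)$ is a real function of $\mathcal S_i$ and $\mathcal D$. It is elicitable with respect to a finite family $\mathcal R$ of random variables if there is a payment $\pi(r,\mathcal R)$, not depending on $\mathcal D$, such that under every prior $Q$ is almost surely the unique maximizer over $r\in\mathbb R$ of $\mathbb E_{\mathcal D}[\pi(r,\mathcal R)\mid\mathcal S_i]$. A directed acyclic graph $G$ on $\mathcal Q\cup\{Y\}$, for a finite list $\mathcal Q$ of queries, DAG-elicits $\mathcal Q$ if $Y$ is its unique sink and every $Q\in\mathcal Q$ is elicitable with respect to the set $N_G(Q)$ of its out-neighbours. The order complexity of $\mathcal Q$ is the minimum, over all $G$ that DAG-elicit $\mathcal Q$,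 of the maximum over $Q\in\mathcal Q$ of the length of a longest path from $Q$ to $Y$. The agent complexity is the minimum, over the same graphs, of the maximum over $Q\in\mathcal Q$ of the number of distinct experts $\mathsf{agent}(Q')$ with $Q'\in\mathcal Q$ reachable from $Q$ (including $Q'=Q$). A linear aggregation rule is a pair $(\mathcal Q,f)$ such that, for some $G$ that DAG-elicits $\mathcal Q$ and some constants $\alpha_{Q,Q'}$ (the same for all priors), each $Q\in\mathcal Q$ equals $\mathbb E_{\mathcal D}\big[\sum_{Q'\in N_G(Q)}\alpha_{Q,Q'}Q'\mid\mathcal S_{\mathsf{agent}(Q)}\big]$ almost surely under every prior, and $f(\mathcal Q)=\sum_{Q\in\mathcal Q}\beta_Q Q$ for some constants $\beta_Q$. A randomized linear aggregation rule draws a context $Z\sim P$, independent of the signals, and then uses a rule $(\mathcal Q_Z,f_Z)$ that is almost surely a linear aggregation rule; its output $f_Z(\mathcal Q_Z)$ is the approximator that it implements. Let $\mathcal A_d^{\mathrm{lin}}$ be the set of all approximators (real random variables, one under each prior) implemented by randomized linear aggregation rules for which $\mathcal Q_Z$ has order complexity and agent complexity at most $d$, almost surely. The worst-case error of an approximator $A$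 is $$\mathsf{error}(A)=\max_{\mathcal D}\frac{\mathbb E[(A-Y)^2]}{\operatorname{Var}_{\mathcal D}(Y)}\in[0,\infty],$$ the maximum being over all priors. **Proposition.** Let $n\ge2$, $d\ge1$ and $q(n)=\dfrac{\sqrt n+1}{\sqrt n-1}$. For every $A\in\mathcal A_d^{\mathrm{lin}}$ the maximum that defines $\mathsf{error}(A)$ is attained, and the minimum $\min_{A\in\mathcal A_d^{\mathrm{lin}}}\mathsf{error}(A)$ is attained. Moreover $$\min_{A\in\mathcal A_d^{\mathrm{lin}}}\mathsf{error}(A)=\frac{4}{\left(q(n)^d+q(n)^{-d}\right)^2}$$ if and only if $d=1$, or $d=2$ and $n$ is odd, or $d=3$ and $n\equiv1\pmod 4$. The equality also holds if and only if every point $x\in[1,n]$ at which $|\hat T_d|$ attains its maximum over $[1,n]$ is an integer, where $$\hat T_d(x)=\frac{T_d\!\left(\frac{2x-(n+1)}{n-1}\right)}{T_d\!\left(-\frac{n+1}{n-1}\right)}$$ and $T_d$ is the $d$-th Chebyshev polynomial of the first kind. -/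

import Mathlib

open MeasureTheory ProbabilityTheory

noncomputable section

namespace PartialInfo

/-- A realization of the signals: one real number `x T` for every set `T` of experts.
The experts are the elements of `Fin n`. -/
abbrev Signals (n : ℕ) : Type := Finset (Fin n) → ℝ

/-- A prior of the partial information model: the laws of the independent signals `X_T`. They are
centred and square-integrable, `X_∅ = 0` almost surely, and at least one has positive variance. -/
structure Prior (n : ℕ) where
  law : Finset (Fin n) → ProbabilityMeasure ℝ
  memLp : ∀ T, MemLp (fun x : ℝ => x) 2 (law T : Measure ℝ)
  mean_zero : ∀ T, ∫ x : ℝ, x ∂(law T : Measure ℝ) = 0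
  law_empty : (law ∅ : Measure ℝ) = Measure.dirac 0
  exists_variance_pos : ∃ T, 0 < variance (fun x : ℝ => x) (law T : Measure ℝ)

/-- The joint law of all signals (they are independent). -/
def Prior.joint {n : ℕ} (D : Prior n) : Measure (Signals n) :=
  Measure.pi fun T => (D.law T : Measure ℝ)

instance {n : ℕ} (D : Prior n) : IsProbabilityMeasure D.joint := by
  unfold Prior.joint; infer_instance

/-- The variable to be estimated: the sum of all signals. -/
def target {n : ℕ} (x : Signals n) : ℝ := ∑ T, x T

/-- The signals that expert `i` observes. -/
def observed {n : ℕ} (i : Fin n) (x : Signals n) : {T : Finset (Fin n) // i ∈ T} → ℝ :=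
  fun T => x T

/-- The σ-algebra generated by the signals that expert `i` observes. -/
abbrev info {n : ℕ} (i : Fin n) : MeasurableSpace (Signals n) :=
  MeasurableSpace.comap (observed i) inferInstance

/-- A query put to an expert: a real function of the prior and of what the expert observes. -/
structure Query (n : ℕ) where
  agent : Fin n
  answer : Prior n → ({T : Finset (Fin n) // agent ∈ T} → ℝ) → ℝ
  measurable_answer : ∀ D, Measurable (answer D)

/-- The answer to a query, as a random variable. -/
def Query.val {n : ℕ} (Q : Query n) (D : Prior n) (x : Signals n) : ℝ :=
  Q.answer D (observed Q.agent x)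

/-- `Q` is elicitable with respect to the random variables `R j`: for some payment `π`, not
depending on the prior, the answer to `Q` is almost surely the unique maximizer of the expert's
conditional expected payment. The conditional expectations given the expert's information are
integrals against the regular conditional distribution. -/
def Elicitable {n : ℕ} (Q : Query n) {J : Type} (R : Prior n → J → Signals n → ℝ) : Prop :=
  ∃ π : ℝ → (J → ℝ) → ℝ, (∀ r, Measurable (π r)) ∧
    ∀ D : Prior n, ∀ᵐ x ∂D.joint,
      (∀ r, Integrable (fun y => π r fun j => R D j y)
        (condExpKernel D.joint (info Q.agent) x)) ∧
      ∀ r, r ≠ Q.val D x →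
        ∫ y, π r (fun j => R D j y) ∂(condExpKernel D.joint (info Q.agent) x) <
          ∫ y, π (Q.val D x) (fun j => R D j y) ∂(condExpKernel D.joint (info Q.agent) x)

/-- The random variable at a vertex of an elicitation graph: vertex `some k` is the `k`-th query
and vertex `none` is the target `Y`. -/
def vertexVal {n m : ℕ} (Q : Fin m → Query n) (D : Prior n) : Option (Fin m) → Signals n → ℝ
  | none => target
  | some k => (Q k).val D

/-- `G` DAG-elicits the list of queries `Q`: it is acyclic, `Y` is its unique sink, and every
query is elicitable with respect to its out-neighbours. -/
structure DAGElicits {n m : ℕ} (G : Digraph (Option (Fin m))) (Q : Fin m → Query n) : Prop where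
  acyclic : ∀ v, ¬ Relation.TransGen G.Adj v v
  sink_iff : ∀ v, (∀ w, ¬ G.Adj v w) ↔ v = none
  elicitable : ∀ k, Elicitable (Q k)
    fun D (v : {v : Option (Fin m) // G.Adj (some k) v}) => vertexVal Q D v

/-- There is a directed walk of the given length between two vertices (in an acyclic graph, walks
are paths). -/
inductive HasWalk {V : Type} (G : Digraph V) : V → V → ℕ → Prop
  | nil (v : V) : HasWalk G v v 0
  | cons {u v w : V} {l : ℕ} (h : G.Adj u v) (p : HasWalk G v w l) : HasWalk G u w (l + 1)

/-- The order of the `k`-th query under `G`: the length of a longest path from it to `Y`. -/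
def order {m : ℕ} (G : Digraph (Option (Fin m))) (k : Fin m) : ℕ∞ :=
  ⨆ (l : ℕ) (_ : HasWalk G (some k) none l), (l : ℕ∞)

/-- The experts whose beliefs are relevant to the `k`-th query under `G`: those who answer a query
reachable from it (itself included). -/
def relevantAgents {n m : ℕ} (Q : Fin m → Query n) (G : Digraph (Option (Fin m)))
    (k : Fin m) : Set (Fin n) :=
  {i | ∃ j, Relation.ReflTransGen G.Adj (some k) (some j) ∧ (Q j).agent = i}

/-- Order complexity of a list of queries: least maximal order over all graphs that DAG-elicit
it (`⊤` if there is none). -/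
def orderComplexity {n m : ℕ} (Q : Fin m → Query n) : ℕ∞ :=
  ⨅ (G : Digraph (Option (Fin m))) (_ : DAGElicits G Q), ⨆ k, order G k

/-- Agent complexity of a list of queries: least maximal number of relevant experts over all
graphs that DAG-elicit it (`⊤` if there is none). -/
def agentComplexity {n m : ℕ} (Q : Fin m → Query n) : ℕ∞ :=
  ⨅ (G : Digraph (Option (Fin m))) (_ : DAGElicits G Q), ⨆ k, (relevantAgents Q G k).encard

/-- A deterministic aggregation rule: a finite list of queries and a function of the answers. -/
structure AggRule (n : ℕ) where
  size : ℕ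
  query : Fin size → Query n
  agg : (Fin size → ℝ) → ℝ

/-- The output of a deterministic aggregation rule. -/
def AggRule.output {n : ℕ} (R : AggRule n) (D : Prior n) (x : Signals n) : ℝ :=
  R.agg fun k => (R.query k).val D x

open Classical in
/-- Linear aggregation rules. For some graph that DAG-elicits the queries, every query is the
conditional expectation of a linear combination, with constant coefficients (the same for all
priors), of its out-neighbours; and the aggregation function is linear. -/
def AggRule.IsLinear {n : ℕ} (R : AggRule n) : Prop :=
  (∃ G : Digraph (Option (Fin R.size)), DAGElicits G R.query ∧
    ∃ α : Fin R.size → Option (Fin R.size) → ℝ, ∀ (D : Prior n) (k : Fin R.size),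
      (R.query k).val D =ᵐ[D.joint]
        D.joint[fun x => ∑ v with G.Adj (some k) v, α k v * vertexVal R.query D v x
          | info (R.query k).agent]) ∧
  ∃ β : Fin R.size → ℝ, ∀ a : Fin R.size → ℝ, R.agg a = ∑ k, β k * a k

/-- A (randomized) approximator: under each prior, a real random variable that depends on the
signals and on an independent random context `z` with law `P`. -/
structure Approximator (n : ℕ) where
  Context : Type
  [mContext : MeasurableSpace Context]
  P : Measure Context
  [isProbabilityMeasure : IsProbabilityMeasure P]
  val : Prior n → Context → Signals n → ℝ
  aemeasurable_val : ∀ D : Prior n,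
    AEMeasurable (fun p : Context × Signals n => val D p.1 p.2) (P.prod D.joint)

attribute [instance] Approximator.mContext Approximator.isProbabilityMeasure

/-- `A` is implemented by the randomized aggregation rule that draws `z` from `A.P` and then uses
the rule `R z`. -/
def Approximator.ImplementedBy {n : ℕ} (A : Approximator n) (R : A.Context → AggRule n) : Prop :=
  ∀ D : Prior n, ∀ᵐ p ∂(A.P.prod D.joint), A.val D p.1 p.2 = (R p.1).output D p.2

/-- The approximators implemented by randomized linear aggregation rules of agent and order
complexity at most `d`. The requirements on the rules in the support of the randomized rule are
requirements on almost every context. -/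
def linApproximators (n d : ℕ) : Set (Approximator n) :=
  {A | ∃ R : A.Context → AggRule n, A.ImplementedBy R ∧
    ∀ᵐ z ∂A.P, (R z).IsLinear ∧
      agentComplexity (R z).query ≤ d ∧ orderComplexity (R z).query ≤ d}

/-- The expected squared error of `A` under the prior `D`. -/
def Approximator.loss {n : ℕ} (A : Approximator n) (D : Prior n) : ENNReal :=
  ∫⁻ p, ENNReal.ofReal ((A.val D p.1 p.2 - target p.2) ^ 2) ∂(A.P.prod D.joint)

/-- The expected squared error of `A` under `D`, normalized by the variance of the target. -/
def Approximator.relLoss {n : ℕ} (A : Approximator n) (D : Prior n) : ENNReal :=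
  A.loss D / evariance target D.joint

/-- The worst-case error of `A` over all priors. -/
def Approximator.error {n : ℕ} (A : Approximator n) : ENNReal :=
  ⨆ D : Prior n, A.relLoss D

/-- `q(n) = (√n + 1) / (√n - 1)`. -/
def q (n : ℕ) : ℝ := (√(n : ℝ) + 1) / (√(n : ℝ) - 1)

/-- The affine map that carries `[1, n]` onto `[-1, 1]`. -/
def toUnit (n : ℕ) (x : ℝ) : ℝ := (2 * x - (n + 1)) / (n - 1)

/-- The Chebyshev polynomial of degree `d`, shifted to `[1, n]` and normalized to be `1` at `0`. -/
def shiftedChebyshev (n d : ℕ) (x : ℝ) : ℝ :=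
  (Polynomial.Chebyshev.T ℝ d).eval (toUnit n x) / (Polynomial.Chebyshev.T ℝ d).eval (toUnit n 0)

end PartialInfo

end

noncomputable section

namespace PartialInfo

/-!
The conditional expectation given the signals of expert `i` multiplies the coefficient of each
`X_T` by the indicator of `i ∈ T`. A query that is elicitable from linear combinations of signals
must therefore lie in the span of products of such indicators with the coefficients of its
references, so the linear rules of order at most `d` produce exactly the combinations `∑ f(T) X_T`
whose coefficient function `f` is a Boolean function of degree at most `d` with `f(∅) = 0`. The
loss is the sum of the `(f(T) - 1)²` weighted by the variances of the signals, so the worst-case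
error is the squared uniform distance of `f` from `1` on the nonempty sets, and by Jensen's
inequality randomization does not improve on the mean coefficient function. Symmetrization turns
the minimum over `f` into a best approximation problem for polynomials of degree `d` on the integer
points `1, …, n`, where the Chebyshev polynomial of `[1, n]` is optimal if and only if all its
extremal points are integers; a node that is not an integer leaves room for a perturbation. The
extremal points are affine images of the numbers `cos (i π / d)`, and Niven's theorem leaves only
`d ≤ 3`.
-/

section Chebyshev

open Polynomial Polynomial.Chebyshev

theorem eval_eq_sum_node {d : ℕ} {p : ℝ[X]} (hp : p.natDegree ≤ d) (x : ℝ) :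
    p.eval x = ∑ i ∈ Finset.range (d + 1), p.eval (node d i) *
      ((∏ j ∈ (Finset.range (d + 1)).erase i, (node d i - node d j))⁻¹ *
        ∏ j ∈ (Finset.range (d + 1)).erase i, (x - node d j)) := by
  have hdeg : p.degree < (Finset.range (d + 1)).card := by
    rw [Finset.card_range]
    exact (natDegree_le_iff_degree_le.1 hp).trans_lt (by exact_mod_cast d.lt_succ_self)
  conv_lhs => rw [Lagrange.eq_interpolate (strictAntiOn_node d).injOn hdeg]
  rw [Lagrange.interpolate_apply, eval_finsetSum]
  refine Finset.sum_congr rfl fun i _ => ?_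
  simp [Lagrange.basis, Lagrange.basisDivisor, eval_prod, Finset.prod_mul_distrib]

-- The Lagrange coefficients at a point to the right of `1` alternate in sign, as do the values
-- of `T d` at the nodes.
theorem eval_le_mul_eval_T {d : ℕ} {p : ℝ[X]} (hp : p.natDegree ≤ d) {c : ℝ}
    (hc : ∀ i ≤ d, |p.eval (node d i)| ≤ c) {x : ℝ} (hx : 1 ≤ x) :
    p.eval x ≤ c * (T ℝ d).eval x := by
  rw [eval_eq_sum_node hp, eval_eq_sum_node (d := d) (p := T ℝ d) (by simp), Finset.mul_sum]
  refine Finset.sum_le_sum fun i hi => ?_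
  have hid : i ≤ d := Finset.mem_range_succ_iff.1 hi
  have sign_sq : ((-1 : ℝ) ^ i) * (-1) ^ i = 1 := by rw [← mul_pow]; simp
  have hcoeff : 0 < (-1 : ℝ) ^ i *
      (∏ j ∈ (Finset.range (d + 1)).erase i, (node d i - node d j))⁻¹ := by
    simpa [mul_inv, ← inv_pow, mul_comm] using inv_pos.2 (zero_lt_prod_node_sub_node hid)
  have hval : p.eval (node d i) * (-1) ^ i ≤ c := by
    refine (le_abs_self _).trans ?_
    rw [abs_mul, abs_neg_one_pow, mul_one]
    exact hc i hid
  rw [eval_T_real_node (Finset.mem_Iic.2 hid), ← mul_assoc, ← mul_assoc, ← mul_assoc]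
  refine mul_le_mul_of_nonneg_right ?_ (Finset.prod_nonneg fun j _ =>
    sub_nonneg.2 (node_mem_Icc.2.trans hx))
  calc p.eval (node d i) * (∏ j ∈ (Finset.range (d + 1)).erase i, (node d i - node d j))⁻¹
      = p.eval (node d i) * (-1) ^ i * ((-1) ^ i *
          (∏ j ∈ (Finset.range (d + 1)).erase i, (node d i - node d j))⁻¹) := by
        linear_combination (-(p.eval (node d i) *
          (∏ j ∈ (Finset.range (d + 1)).erase i, (node d i - node d j))⁻¹)) * sign_sq
    _ ≤ _ := (mul_le_mul_of_nonneg_right hval hcoeff.le).trans_eq (mul_assoc _ _ _).symm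

/-- The Chebyshev polynomial of degree `d` carried from `[-1, 1]` to `[a, b]`. The orientation is
reversed (`a` corresponds to `1`), so that the polynomial is at least `1` to the left of `a`. -/
def chebyshevPolyIcc (a b : ℝ) (d : ℕ) : ℝ[X] :=
  (T ℝ d).comp (C ((a + b) / (b - a)) - C (2 / (b - a)) * X)

/-- The extremal points `cos (i π / d)` of the Chebyshev polynomial, carried to `[a, b]`; they
increase with `i`, from `a` to `b`. -/
def nodeIcc (a b : ℝ) (d i : ℕ) : ℝ := ((a + b) - (b - a) * node d i) / 2

theorem eval_chebyshevPolyIcc (a b : ℝ) (d : ℕ) (x : ℝ) :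
    (chebyshevPolyIcc a b d).eval x = (T ℝ d).eval ((a + b - 2 * x) / (b - a)) := by
  simp only [chebyshevPolyIcc, eval_comp, eval_sub, eval_mul, eval_C, eval_X]
  congr 1
  ring

theorem natDegree_chebyshevPolyIcc_le (a b : ℝ) (d : ℕ) :
    (chebyshevPolyIcc a b d).natDegree ≤ d := by
  have hlin : (C ((a + b) / (b - a)) - C (2 / (b - a)) * X).natDegree ≤ 1 := by compute_degree
  calc (chebyshevPolyIcc a b d).natDegree ≤ _ := natDegree_comp_le
    _ ≤ d * 1 := Nat.mul_le_mul (by simp) hlin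
    _ = d := mul_one d

variable {a b : ℝ} {d : ℕ}

theorem nodeIcc_zero : nodeIcc a b d 0 = a := by
  rw [nodeIcc, node_eq_one]; ring

theorem nodeIcc_self (hd : d ≠ 0) : nodeIcc a b d d = b := by
  rw [nodeIcc, node_eq_neg_one hd]; ring

theorem nodeIcc_mem_Icc (hab : a ≤ b) (i : ℕ) : nodeIcc a b d i ∈ Set.Icc a b := by
  have hnode := node_mem_Icc (n := d) (i := i)
  constructor <;> rw [nodeIcc] <;> nlinarith [hnode.1, hnode.2]

theorem one_le_eval_chebyshevPolyIcc (hab : a < b) (d : ℕ) {x : ℝ} (hx : x ≤ a) :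
    1 ≤ (chebyshevPolyIcc a b d).eval x := by
  rw [eval_chebyshevPolyIcc]
  refine one_le_eval_T_real d ?_
  rw [le_div_iff₀ (by linarith)]
  linarith

theorem abs_eval_chebyshevPolyIcc_le_one (hab : a < b) (d : ℕ) {x : ℝ} (hx : x ∈ Set.Icc a b) :
    |(chebyshevPolyIcc a b d).eval x| ≤ 1 := by
  rw [eval_chebyshevPolyIcc]
  refine abs_eval_T_real_le_one d ?_
  rw [abs_le, le_div_iff₀ (by linarith), div_le_iff₀ (by linarith)]
  constructor <;> linarith [hx.1, hx.2]

theorem abs_eval_chebyshevPolyIcc_eq_one_iff (hab : a < b) (hd : d ≠ 0) {x : ℝ} :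
    |(chebyshevPolyIcc a b d).eval x| = 1 ↔ ∃ i ≤ d, x = nodeIcc a b d i := by
  rw [eval_chebyshevPolyIcc, abs_eval_T_real_eq_one_iff hd]
  refine exists_congr fun i => and_congr_right fun _ => ?_
  rw [nodeIcc, node, div_eq_iff (sub_pos.2 hab).ne', eq_div_iff two_ne_zero]
  constructor <;> intro h <;> linarith

theorem eval_le_mul_eval_chebyshevPolyIcc (hab : a < b) {p : ℝ[X]} (hp : p.natDegree ≤ d) {c : ℝ}
    (hc : ∀ i ≤ d, |p.eval (nodeIcc a b d i)| ≤ c) {x : ℝ} (hx : x ≤ a) :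
    p.eval x ≤ c * (chebyshevPolyIcc a b d).eval x := by
  have hba : b - a ≠ 0 := (sub_pos.2 hab).ne'
  let P : ℝ[X] := p.comp (C ((a + b) / 2) - C ((b - a) / 2) * X)
  have eval_P : ∀ y, P.eval y = p.eval (((a + b) - (b - a) * y) / 2) := by
    intro y
    simp only [P, eval_comp, eval_sub, eval_mul, eval_C, eval_X]
    congr 1
    ring
  have natDegree_P : P.natDegree ≤ d := by
    have hlin : (C ((a + b) / 2) - C ((b - a) / 2) * X).natDegree ≤ 1 := by compute_degree
    calc P.natDegree ≤ _ := natDegree_comp_le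
      _ ≤ d * 1 := Nat.mul_le_mul hp hlin
      _ = d := mul_one d
  have hx' : 1 ≤ (a + b - 2 * x) / (b - a) := by rw [le_div_iff₀ (by linarith)]; linarith
  have h := eval_le_mul_eval_T natDegree_P (fun i hi => (eval_P _).symm ▸ hc i hi) hx'
  rwa [eval_P, ← eval_chebyshevPolyIcc, mul_div_cancel₀ _ hba, sub_sub_cancel,
    mul_div_cancel_left₀ _ two_ne_zero] at h

-- Perturb `t` towards a polynomial that takes the value `-t` wherever `|t| = c`.
theorem exists_natDegree_le_forall_abs_eval_lt {t : ℝ[X]} (ht : t.natDegree ≤ d) {s : Finset ℝ}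
    {x₀ c : ℝ} (hx₀ : x₀ ∉ s) (hc : 0 < c) (hts : ∀ y ∈ s, |t.eval y| ≤ c)
    (hcard : {y ∈ s | |t.eval y| = c}.card ≤ d) :
    ∃ p : ℝ[X], p.natDegree ≤ d ∧ p.eval x₀ = t.eval x₀ ∧ ∀ y ∈ s, |p.eval y| < c := by
  let E : Finset ℝ := {y ∈ s | |t.eval y| = c}
  have hx₀E : x₀ ∉ E := fun h => hx₀ (Finset.mem_of_mem_filter _ h)
  let val : ℝ → ℝ := fun y => if y = x₀ then 0 else -t.eval y
  let r : ℝ[X] := Lagrange.interpolate (insert x₀ E) id val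
  have eval_r : ∀ y ∈ insert x₀ E, r.eval y = val y := fun y hy =>
    Lagrange.eval_interpolate_at_node val Function.injective_id.injOn hy
  have natDegree_r : r.natDegree ≤ d := by
    have h := Lagrange.degree_interpolate_le (s := insert x₀ E) val Function.injective_id.injOn
    rw [Finset.card_insert_of_notMem hx₀E, Nat.add_sub_cancel] at h
    exact natDegree_le_iff_degree_le.2 (h.trans (by exact_mod_cast hcard))
  have small : ∀ y ∈ s, ∀ᶠ ε : ℝ in nhdsWithin 0 (Set.Ioi 0),
      |t.eval y + ε * r.eval y| < c := by
    intro y hy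
    rcases (hts y hy).eq_or_lt with hyc | hyc
    · have hyE : y ∈ E := Finset.mem_filter.2 ⟨hy, hyc⟩
      have hr : r.eval y = -t.eval y := by
        rw [eval_r y (Finset.mem_insert_of_mem hyE)]
        exact if_neg fun h : y = x₀ => hx₀ (h ▸ hy)
      filter_upwards [Ioo_mem_nhdsGT (zero_lt_one' ℝ)] with ε hε
      rw [hr, show t.eval y + ε * -t.eval y = (1 - ε) * t.eval y by ring, abs_mul, hyc,
        abs_of_pos (by linarith [hε.2])]
      nlinarith [hε.1]
    · have hcont : Continuous fun ε : ℝ => |t.eval y + ε * r.eval y| := by fun_prop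
      exact nhdsWithin_le_nhds
        (hcont.continuousAt.eventually_lt continuousAt_const (by simpa using hyc))
  obtain ⟨ε, hε⟩ := ((Filter.eventually_all_finset s).2 small).exists
  refine ⟨t + C ε * r, ?_, ?_, fun y hy => by simpa using hε y hy⟩
  · exact (natDegree_add_le _ _).trans (max_le ht ((natDegree_C_mul_le _ _).trans natDegree_r))
  · simp [eval_r x₀ (Finset.mem_insert_self x₀ E), val]

theorem exists_eval_eq_one_forall_abs_eval_lt (hab : a < b) (hd : d ≠ 0) {s : Finset ℝ}
    (hs : ∀ y ∈ s, y ∈ Set.Icc a b) {x₀ : ℝ} (hx₀ : x₀ < a)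
    (hnode : ∃ i ≤ d, nodeIcc a b d i ∉ s) :
    ∃ p : ℝ[X], p.natDegree ≤ d ∧ p.eval x₀ = 1 ∧
      ∀ y ∈ s, |p.eval y| < ((chebyshevPolyIcc a b d).eval x₀)⁻¹ := by
  obtain ⟨i₀, hi₀, hi₀s⟩ := hnode
  have hτ : 0 < (chebyshevPolyIcc a b d).eval x₀ :=
    zero_lt_one.trans_le (one_le_eval_chebyshevPolyIcc hab d hx₀.le)
  have hcard : {y ∈ s | |(chebyshevPolyIcc a b d).eval y| = 1}.card ≤ d := by
    have hsub : {y ∈ s | |(chebyshevPolyIcc a b d).eval y| = 1} ⊆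
        ((Finset.range (d + 1)).erase i₀).image (nodeIcc a b d) := by
      intro y hy
      obtain ⟨hys, hy1⟩ := Finset.mem_filter.1 hy
      obtain ⟨i, hi, rfl⟩ := (abs_eval_chebyshevPolyIcc_eq_one_iff hab hd).1 hy1
      refine Finset.mem_image_of_mem _ (Finset.mem_erase.2 ⟨?_, Finset.mem_range_succ_iff.2 hi⟩)
      rintro rfl
      exact hi₀s hys
    refine (Finset.card_le_card hsub).trans (Finset.card_image_le.trans ?_)
    rw [Finset.card_erase_of_mem (Finset.mem_range_succ_iff.2 hi₀), Finset.card_range]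
    omega
  obtain ⟨p, hp, hp₀, hps⟩ := exists_natDegree_le_forall_abs_eval_lt
    (natDegree_chebyshevPolyIcc_le a b d) (fun h => hx₀.not_ge (hs _ h).1) zero_lt_one
    (fun y hy => abs_eval_chebyshevPolyIcc_le_one hab d (hs y hy)) hcard
  refine ⟨C ((chebyshevPolyIcc a b d).eval x₀)⁻¹ * p, (natDegree_C_mul_le _ _).trans hp, ?_, ?_⟩
  · rw [eval_mul, eval_C, hp₀, inv_mul_cancel₀ hτ.ne']
  · intro y hy
    rw [eval_mul, eval_C, abs_mul, abs_of_pos (inv_pos.2 hτ)]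
    exact mul_lt_of_lt_one_right (inv_pos.2 hτ) (hps y hy)

end Chebyshev

section IntegerNodes

open Polynomial.Chebyshev

/-- All extremal points over `[1, n]` of the Chebyshev polynomial of degree `d` are integers. This
is the condition under which the Chebyshev bound is sharp on `{1, …, n}`. -/
def HasIntegerNodes (n d : ℕ) : Prop :=
  ∀ i ≤ d, ∃ k : ℤ, nodeIcc 1 n d i = k

theorem node_two_one : node 2 1 = 0 := by
  rw [node]; norm_num

theorem node_three_one : node 3 1 = 1 / 2 := by
  rw [node, ← Real.cos_pi_div_three]; norm_num

theorem node_three_two : node 3 2 = -(1 / 2) := by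
  rw [node, ← Real.cos_pi_div_three, ← Real.cos_pi_sub]
  congr 1; push_cast; ring

theorem irrational_node_one {d : ℕ} (hd : 4 ≤ d) : Irrational (node d 1) := by
  have hden : 3 < (1 / d : ℚ).den := by
    rw [one_div, Rat.inv_natCast_den]
    split_ifs <;> omega
  have hirr := irrational_cos_rat_mul_pi hden
  rwa [node, show ((1 : ℕ) : ℝ) * Real.pi / d = ((1 / d : ℚ) : ℝ) * Real.pi by push_cast; ring]

theorem hasIntegerNodes_iff_forall_Ioo {n d : ℕ} (hd : d ≠ 0) :
    HasIntegerNodes n d ↔ ∀ i ∈ Set.Ioo 0 d, ∃ k : ℤ, nodeIcc 1 n d i = k := by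
  refine ⟨fun h i hi => h i hi.2.le, fun h i hi => ?_⟩
  rcases Nat.eq_zero_or_pos i with rfl | hi0
  · exact ⟨1, by rw [nodeIcc_zero, Int.cast_one]⟩
  · rcases hi.eq_or_lt with rfl | hid
    · exact ⟨n, by rw [nodeIcc_self hd, Int.cast_natCast]⟩
    · exact h i ⟨hi0, hid⟩

theorem hasIntegerNodes_one (n : ℕ) : HasIntegerNodes n 1 :=
  (hasIntegerNodes_iff_forall_Ioo one_ne_zero).2 fun i hi => by
    have := hi.1; have := hi.2; omega

theorem hasIntegerNodes_two_iff {n : ℕ} : HasIntegerNodes n 2 ↔ Odd n := by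
  have hnode : nodeIcc 1 n 2 1 = (n + 1) / 2 := by rw [nodeIcc, node_two_one]; ring
  rw [hasIntegerNodes_iff_forall_Ioo two_ne_zero]
  refine ⟨fun h => ?_, fun ⟨m, hm⟩ i hi => ⟨m + 1, ?_⟩⟩
  · obtain ⟨k, hk⟩ := h 1 (by simp)
    have : (n : ℤ) + 1 = 2 * k := by
      have : (n : ℝ) + 1 = 2 * k := by linarith
      exact_mod_cast this
    rw [Nat.odd_iff]; omega
  · obtain rfl : i = 1 := by have := hi.1; have := hi.2; omega
    rw [hnode, hm]; push_cast; ring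

theorem hasIntegerNodes_three_iff {n : ℕ} : HasIntegerNodes n 3 ↔ n ≡ 1 [MOD 4] := by
  have hnode₁ : nodeIcc 1 n 3 1 = (n + 3) / 4 := by rw [nodeIcc, node_three_one]; ring
  have hnode₂ : nodeIcc 1 n 3 2 = (3 * n + 1) / 4 := by rw [nodeIcc, node_three_two]; ring
  rw [hasIntegerNodes_iff_forall_Ioo three_ne_zero]
  refine ⟨fun h => ?_, fun hn i hi => ?_⟩
  · obtain ⟨k, hk⟩ := h 1 (by simp)
    have : (n : ℤ) + 3 = 4 * k := by
      have : (n : ℝ) + 3 = 4 * k := by linarith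
      exact_mod_cast this
    rw [Nat.ModEq]; omega
  · obtain ⟨m, rfl⟩ : ∃ m, n = 4 * m + 1 := ⟨n / 4, by rw [Nat.ModEq] at hn; omega⟩
    obtain rfl | rfl : i = 1 ∨ i = 2 := by have := hi.1; have := hi.2; omega
    · exact ⟨m + 1, by rw [hnode₁]; push_cast; ring⟩
    · exact ⟨3 * m + 1, by rw [hnode₂]; push_cast; ring⟩

theorem not_hasIntegerNodes {n d : ℕ} (hn : 2 ≤ n) (hd : 4 ≤ d) : ¬ HasIntegerNodes n d := by
  intro h
  obtain ⟨k, hk⟩ := h 1 (by omega)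
  have h2 : (2 : ℝ) ≤ n := by exact_mod_cast hn
  refine irrational_node_one hd ⟨((n + 1) - 2 * k) / (n - 1), ?_⟩
  rw [nodeIcc] at hk
  push_cast
  rw [div_eq_iff (by linarith)]
  linarith

theorem hasIntegerNodes_iff {n d : ℕ} (hn : 2 ≤ n) (hd : 1 ≤ d) :
    HasIntegerNodes n d ↔ d = 1 ∨ (d = 2 ∧ Odd n) ∨ (d = 3 ∧ n ≡ 1 [MOD 4]) := by
  rcases (by omega : d = 1 ∨ d = 2 ∨ d = 3 ∨ 4 ≤ d) with rfl | rfl | rfl | h4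
  · simp [hasIntegerNodes_one]
  · simp [hasIntegerNodes_two_iff]
  · simp [hasIntegerNodes_three_iff]
  · exact iff_of_false (not_hasIntegerNodes hn h4) (by omega)

theorem inv_eval_chebyshevPolyIcc_zero {n : ℕ} (hn : 2 ≤ n) (d : ℕ) :
    ((chebyshevPolyIcc 1 n d).eval 0)⁻¹ = 2 / (q n ^ (d : ℤ) + q n ^ (-(d : ℤ))) := by
  have h2 : (2 : ℝ) ≤ n := by exact_mod_cast hn
  have hs : 1 < √(n : ℝ) := by rw [Real.lt_sqrt] <;> linarith
  have hq : 0 < q n := div_pos (by linarith) (by linarith)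
  have hcosh : (1 + (n : ℝ) - 2 * 0) / (n - 1) = Real.cosh (Real.log (q n)) := by
    have hsub : √(n : ℝ) - 1 ≠ 0 := by linarith
    have hadd : √(n : ℝ) + 1 ≠ 0 := by linarith
    have hsq : √(n : ℝ) ^ 2 = n := Real.sq_sqrt (by linarith)
    rw [Real.cosh_eq, Real.exp_neg, Real.exp_log hq, q,
      show (n : ℝ) - 1 = (√(n : ℝ) - 1) * (√(n : ℝ) + 1) by linear_combination -hsq]
    field_simp
    linear_combination -2 * hsq
  have hexp : ∀ k : ℤ, Real.exp (k * Real.log (q n)) = q n ^ k := fun k => by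
    rw [mul_comm, ← Real.rpow_def_of_pos hq, Real.rpow_intCast]
  rw [eval_chebyshevPolyIcc, hcosh, T_real_cosh, Real.cosh_eq, hexp, ← neg_mul, ← Int.cast_neg,
    hexp, inv_div]

theorem shiftedChebyshev_eq (n d : ℕ) (x : ℝ) :
    shiftedChebyshev n d x =
      (chebyshevPolyIcc 1 n d).eval x / (chebyshevPolyIcc 1 n d).eval 0 := by
  have hunit : ∀ y : ℝ, toUnit n y = -((1 + n - 2 * y) / (n - 1)) := fun y => by
    rw [toUnit]; ring
  rw [shiftedChebyshev, hunit, hunit, T_eval_neg, T_eval_neg, eval_chebyshevPolyIcc,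
    eval_chebyshevPolyIcc]
  exact mul_div_mul_left _ _ (by exact_mod_cast (Int.negOnePow d).ne_zero)

theorem isMaxOn_abs_shiftedChebyshev_iff {n d : ℕ} (hn : 2 ≤ n) (hd : d ≠ 0) {x : ℝ}
    (hx : x ∈ Set.Icc (1 : ℝ) n) :
    IsMaxOn (fun y => |shiftedChebyshev n d y|) (Set.Icc (1 : ℝ) n) x ↔
      ∃ i ≤ d, x = nodeIcc 1 n d i := by
  have h1n : (1 : ℝ) < n := by exact_mod_cast hn
  have hτ : 0 < |(chebyshevPolyIcc 1 n d).eval 0| :=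
    abs_pos.2 (zero_lt_one.trans_le (one_le_eval_chebyshevPolyIcc h1n d zero_le_one)).ne'
  simp only [isMaxOn_iff, shiftedChebyshev_eq, abs_div, div_le_div_iff_of_pos_right hτ,
    ← abs_eval_chebyshevPolyIcc_eq_one_iff h1n hd]
  constructor
  · intro h
    refine le_antisymm (abs_eval_chebyshevPolyIcc_le_one h1n d hx) ?_
    exact ((abs_eval_chebyshevPolyIcc_eq_one_iff h1n hd).2 ⟨0, d.zero_le, rfl⟩).ge.trans
      (h _ (nodeIcc_mem_Icc h1n.le 0))
  · intro h y hy
    exact (abs_eval_chebyshevPolyIcc_le_one h1n d hy).trans_eq h.symm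

theorem forall_isMaxOn_isInt_iff {n d : ℕ} (hn : 2 ≤ n) (hd : d ≠ 0) :
    (∀ x ∈ Set.Icc (1 : ℝ) n,
      IsMaxOn (fun y => |shiftedChebyshev n d y|) (Set.Icc (1 : ℝ) n) x → ∃ k : ℤ, x = k) ↔
    HasIntegerNodes n d := by
  have hmem : ∀ i, nodeIcc 1 n d i ∈ Set.Icc (1 : ℝ) n :=
    nodeIcc_mem_Icc (by exact_mod_cast one_le_two.trans hn)
  constructor
  · intro h i hi
    exact h _ (hmem i) ((isMaxOn_abs_shiftedChebyshev_iff hn hd (hmem i)).2 ⟨i, hi, rfl⟩)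
  · intro h x hx hmax
    obtain ⟨i, hi, rfl⟩ := (isMaxOn_abs_shiftedChebyshev_iff hn hd hx).1 hmax
    exact h i hi

end IntegerNodes

section LowDegree

open Polynomial

/-- The indicator of the supersets of `S`, that is, the monomial `∏ i ∈ S, x i` as a function on
the Boolean cube. -/
def supersetInd {α : Type*} [DecidableEq α] (S T : Finset α) : ℝ := if S ⊆ T then 1 else 0

/-- The real functions on the Boolean cube `{0, 1}^α` of degree at most `d` that vanish at `∅`. -/
def lowDegree (α : Type*) [DecidableEq α] (d : ℕ) : Submodule ℝ (Finset α → ℝ) :=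
  Submodule.span ℝ (supersetInd '' {S | S.Nonempty ∧ S.card ≤ d})

variable {α : Type*} [DecidableEq α] {d : ℕ}

theorem supersetInd_empty : supersetInd (∅ : Finset α) = 1 := by
  funext T; simp [supersetInd]

theorem supersetInd_mul (S S' : Finset α) :
    supersetInd S * supersetInd S' = supersetInd (S ∪ S') := by
  funext T
  simp only [Pi.mul_apply, supersetInd, Finset.union_subset_iff, ite_and]
  split_ifs <;> simp

theorem supersetInd_apply_empty {S : Finset α} (hS : S.Nonempty) : supersetInd S ∅ = 0 :=
  if_neg fun h => hS.ne_empty (Finset.subset_empty.1 h)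

theorem supersetInd_mem_lowDegree {S : Finset α} (hS : S.Nonempty) (hd : S.card ≤ d) :
    supersetInd S ∈ lowDegree α d :=
  Submodule.subset_span ⟨S, ⟨hS, hd⟩, rfl⟩

theorem lowDegree_mono {e : ℕ} (h : d ≤ e) : lowDegree α d ≤ lowDegree α e :=
  Submodule.span_mono (Set.image_mono fun _ hS => ⟨hS.1, hS.2.trans h⟩)

theorem apply_empty_of_mem_lowDegree {f : Finset α → ℝ} (hf : f ∈ lowDegree α d) : f ∅ = 0 := by
  have hle : lowDegree α d ≤ LinearMap.ker (LinearMap.proj (R := ℝ) (∅ : Finset α)) :=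
    Submodule.span_le.2 (by rintro _ ⟨S, hS, rfl⟩; exact supersetInd_apply_empty hS.1)
  exact hle hf

theorem supersetInd_mul_mem_lowDegree (S : Finset α) {f : Finset α → ℝ}
    (hf : f ∈ lowDegree α d) : supersetInd S * f ∈ lowDegree α (S.card + d) := by
  have hle : lowDegree α d ≤
      (lowDegree α (S.card + d)).comap (LinearMap.mulLeft ℝ (supersetInd S)) := by
    refine Submodule.span_le.2 ?_
    rintro _ ⟨S', hS', rfl⟩
    rw [SetLike.mem_coe, Submodule.mem_comap, LinearMap.mulLeft_apply, supersetInd_mul]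
    exact supersetInd_mem_lowDegree (hS'.1.mono Finset.subset_union_right)
      ((Finset.card_union_le _ _).trans (Nat.add_le_add_left hS'.2 _))
  exact hle hf

theorem sum_supersetInd_singleton [Fintype α] (T : Finset α) : ∑ i, supersetInd {i} T = T.card := by
  simp [supersetInd]

theorem card_pow_mem_lowDegree [Finite α] (j : ℕ) :
    (fun T : Finset α => (T.card : ℝ) ^ (j + 1)) ∈ lowDegree α (j + 1) := by
  cases nonempty_fintype α
  induction j with
  | zero =>
    convert (lowDegree α 1).sum_mem (t := Finset.univ)
      (fun i _ => supersetInd_mem_lowDegree (d := 1) (Finset.singleton_nonempty i) (by simp))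
      using 1
    funext T
    rw [Finset.sum_apply, sum_supersetInd_singleton, zero_add, pow_one]
  | succ j ih =>
    convert (lowDegree α (1 + (j + 1))).sum_mem (t := Finset.univ)
      (fun i _ => supersetInd_mul_mem_lowDegree {i} ih) using 1
    · rw [add_comm]
    · funext T
      simp only [Finset.sum_apply, Pi.mul_apply]
      rw [← Finset.sum_mul, sum_supersetInd_singleton, pow_succ']

theorem eval_card_mem_lowDegree [Finite α] {p : ℝ[X]} (hp : p.natDegree ≤ d)
    (hp₀ : p.eval 0 = 0) :
    (fun T : Finset α => p.eval (T.card : ℝ)) ∈ lowDegree α d := by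
  convert (lowDegree α d).sum_mem (t := Finset.range d)
    (f := fun j => p.coeff (j + 1) • fun T : Finset α => (T.card : ℝ) ^ (j + 1))
    (fun j hj => (lowDegree α d).smul_mem _
      (lowDegree_mono (Finset.mem_range.1 hj) (card_pow_mem_lowDegree j))) using 1
  funext T
  rw [eval_eq_sum_range' (Nat.lt_succ_of_le hp), Finset.sum_range_succ',
    coeff_zero_eq_eval_zero, hp₀]
  simp

/-- The errors with which the constant `1` is approximated, uniformly on the nonempty sets, by
functions of degree at most `d` that vanish at `∅`. -/
def uniformErrors (α : Type*) [DecidableEq α] (d : ℕ) : Set ℝ :=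
  {c | ∃ f ∈ lowDegree α d, ∀ T : Finset α, T.Nonempty → |f T - 1| ≤ c}

theorem nonneg_of_mem_uniformErrors [Nonempty α] {c : ℝ} (hc : c ∈ uniformErrors α d) :
    0 ≤ c := by
  obtain ⟨f, -, hf⟩ := hc
  exact (abs_nonneg _).trans (hf {Classical.arbitrary α} (Finset.singleton_nonempty _))

theorem exists_isLeast_uniformErrors (α : Type*) [DecidableEq α] [Finite α] [Nonempty α]
    (d : ℕ) : ∃ δ, IsLeast (uniformErrors α d) δ := by
  cases nonempty_fintype α
  let res : (Finset α → ℝ) →ₗ[ℝ] ({T : Finset α // T.Nonempty} → ℝ) :=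
    LinearMap.funLeft ℝ ℝ Subtype.val
  let V := (lowDegree α d).map res
  have dist_le_iff : ∀ (f : Finset α → ℝ) {c : ℝ}, 0 ≤ c →
      (dist 1 (res f) ≤ c ↔ ∀ T : Finset α, T.Nonempty → |f T - 1| ≤ c) := by
    intro f c hc
    rw [dist_pi_le_iff hc, Subtype.forall]
    refine forall₂_congr fun T hT => ?_
    rw [Real.dist_eq, abs_sub_comm]
    rfl
  obtain ⟨_, hg, hdist⟩ := V.closed_of_finiteDimensional.exists_infDist_eq_dist
    ⟨0, V.zero_mem⟩ 1
  obtain ⟨f, hf, rfl⟩ := Submodule.mem_map.1 hg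
  refine ⟨Metric.infDist 1 (V : Set ({T : Finset α // T.Nonempty} → ℝ)),
    ⟨f, hf, (dist_le_iff f Metric.infDist_nonneg).1 hdist.ge⟩, ?_⟩
  rintro c ⟨f', hf', hc⟩
  exact (Metric.infDist_le_dist_of_mem (Submodule.mem_map_of_mem hf')).trans
    ((dist_le_iff f' (nonneg_of_mem_uniformErrors ⟨f', hf', hc⟩)).2 hc)

variable [Fintype α]

theorem choose_mul_sum_supersetInd_powersetCard (S : Finset α) (k : ℕ) :
    (Fintype.card α).choose S.card * ∑ T ∈ Finset.powersetCard k Finset.univ, supersetInd S T =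
      (Fintype.card α).choose k * k.choose S.card := by
  have hcount : ∑ T ∈ Finset.powersetCard k Finset.univ, supersetInd S T =
      ((Finset.powersetCard k Finset.univ).filter (S ⊆ ·)).card := by
    simp [supersetInd]
  rw [hcount]
  rcases le_or_gt S.card k with h | h
  · rw [Finset.card_filter_powersetCard_subset S _ _ (Finset.subset_univ S) h, Finset.card_univ]
    exact_mod_cast (Nat.choose_mul h).symm
  · rw [Nat.choose_eq_zero_of_lt h, Finset.filter_eq_empty_iff.2]
    · simp
    · intro T hT hST
      have hcard := Finset.card_le_card hST
      rw [(Finset.mem_powersetCard.1 hT).2] at hcard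
      omega

theorem exists_eval_eq_expect_supersetInd {S : Finset α} (hS : S.Nonempty) :
    ∃ p : ℝ[X], p.natDegree ≤ S.card ∧ p.eval 0 = 0 ∧ ∀ k ≤ Fintype.card α,
      (Finset.powersetCard k Finset.univ).expect (supersetInd S) = p.eval (k : ℝ) := by
  have hchoose : ((Fintype.card α).choose S.card : ℝ) ≠ 0 := by
    exact_mod_cast (Nat.choose_pos (Finset.card_le_univ S)).ne'
  have eval_desc : ∀ k : ℕ, (descPochhammer ℝ S.card).eval (k : ℝ) =
      S.card.factorial * k.choose S.card := fun k => by
    rw [descPochhammer_eval_eq_descFactorial, Nat.descFactorial_eq_factorial_mul_choose,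
      Nat.cast_mul]
  refine ⟨C (S.card.factorial * (Fintype.card α).choose S.card : ℝ)⁻¹ *
    descPochhammer ℝ S.card, ?_, ?_, fun k hk => ?_⟩
  · exact (natDegree_C_mul_le _ _).trans (descPochhammer_natDegree ..).le
  · have h := eval_desc 0
    rw [Nat.choose_eq_zero_of_lt hS.card_pos, Nat.cast_zero, mul_zero] at h
    rw [eval_mul, h, mul_zero]
  · have hk₀ : ((Fintype.card α).choose k : ℝ) ≠ 0 := by exact_mod_cast (Nat.choose_pos hk).ne'
    have hfac : (S.card.factorial : ℝ) ≠ 0 := by exact_mod_cast S.card.factorial_ne_zero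
    rw [Finset.expect_eq_sum_div_card, Finset.card_powersetCard, Finset.card_univ, eval_mul,
      eval_desc, eval_C]
    field_simp
    rw [mul_comm, choose_mul_sum_supersetInd_powersetCard]

theorem exists_eval_eq_expect_powersetCard {f : Finset α → ℝ} (hf : f ∈ lowDegree α d) :
    ∃ p : ℝ[X], p.natDegree ≤ d ∧ p.eval 0 = 0 ∧ ∀ k ≤ Fintype.card α,
      (Finset.powersetCard k Finset.univ).expect f = p.eval (k : ℝ) := by
  induction hf using Submodule.span_induction with
  | mem _ h =>
    obtain ⟨S, hS, rfl⟩ := h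
    obtain ⟨p, hp, hp₀, hpk⟩ := exists_eval_eq_expect_supersetInd hS.1
    exact ⟨p, hp.trans hS.2, hp₀, hpk⟩
  | zero => exact ⟨0, by simp, by simp, by simp⟩
  | add f g _ _ hf hg =>
    obtain ⟨p, hp, hp₀, hpk⟩ := hf
    obtain ⟨r, hr, hr₀, hrk⟩ := hg
    refine ⟨p + r, (natDegree_add_le _ _).trans (max_le hp hr), by simp [hp₀, hr₀], ?_⟩
    intro k hk
    simp only [Pi.add_apply, Finset.expect_add_distrib, hpk k hk, hrk k hk, eval_add]
  | smul a f _ hf =>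
    obtain ⟨p, hp, hp₀, hpk⟩ := hf
    refine ⟨a • p, (natDegree_smul_le _ _).trans hp, by simp [hp₀], fun k hk => ?_⟩
    simp only [Pi.smul_apply, smul_eq_mul, ← Finset.mul_expect, hpk k hk, eval_smul]

-- Minsky-Papert symmetrization: averaging over the sets of each size loses nothing.
theorem mem_uniformErrors_iff {c : ℝ} :
    c ∈ uniformErrors α d ↔ ∃ p : ℝ[X], p.natDegree ≤ d ∧ p.eval 0 = 1 ∧
      ∀ k ∈ Finset.Icc 1 (Fintype.card α), |p.eval (k : ℝ)| ≤ c := by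
  have natDegree_one_sub : ∀ {p : ℝ[X]}, p.natDegree ≤ d → (1 - p).natDegree ≤ d := fun hp =>
    (natDegree_sub_le _ _).trans (max_le (by simp) hp)
  constructor
  · rintro ⟨f, hf, hfc⟩
    obtain ⟨p, hp, hp₀, hpk⟩ := exists_eval_eq_expect_powersetCard hf
    refine ⟨1 - p, natDegree_one_sub hp, by simp [hp₀], fun k hk => ?_⟩
    obtain ⟨hk₁, hkα⟩ := Finset.mem_Icc.1 hk
    have hne : (Finset.powersetCard k (Finset.univ : Finset α)).Nonempty :=
      Finset.powersetCard_nonempty.2 (by rwa [Finset.card_univ])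
    rw [eval_sub, eval_one, abs_sub_comm, ← hpk k hkα, ← Finset.expect_const hne (1 : ℝ),
      ← Finset.expect_sub_distrib]
    refine (Finset.abs_expect_le _ _).trans (Finset.expect_le hne fun T hT => hfc T ?_)
    rw [← Finset.card_pos, (Finset.mem_powersetCard.1 hT).2]
    omega
  · rintro ⟨p, hp, hp₀, hpc⟩
    refine ⟨_, eval_card_mem_lowDegree (natDegree_one_sub hp) (by simp [hp₀]), fun T hT => ?_⟩
    rw [eval_sub, eval_one, sub_sub_cancel_left, abs_neg]
    exact hpc T.card (Finset.mem_Icc.2 ⟨hT.card_pos, Finset.card_le_univ T⟩)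

theorem natCast_mem_Icc {k m : ℕ} : (k : ℝ) ∈ Set.Icc 1 (m : ℝ) ↔ k ∈ Finset.Icc 1 m := by
  rw [Set.mem_Icc, Finset.mem_Icc, Nat.one_le_cast, Nat.cast_le]

theorem inv_eval_chebyshevPolyIcc_mem_uniformErrors (hα : 2 ≤ Fintype.card α) :
    ((chebyshevPolyIcc 1 (Fintype.card α) d).eval 0)⁻¹ ∈ uniformErrors α d := by
  have hα' : (1 : ℝ) < Fintype.card α := by exact_mod_cast hα
  have hτ : 0 < (chebyshevPolyIcc 1 (Fintype.card α) d).eval 0 :=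
    zero_lt_one.trans_le (one_le_eval_chebyshevPolyIcc hα' d zero_le_one)
  refine mem_uniformErrors_iff.2 ⟨C ((chebyshevPolyIcc 1 (Fintype.card α) d).eval 0)⁻¹ *
    chebyshevPolyIcc 1 (Fintype.card α) d,
    (natDegree_C_mul_le _ _).trans (natDegree_chebyshevPolyIcc_le _ _ d), ?_, fun k hk => ?_⟩
  · rw [eval_mul, eval_C, inv_mul_cancel₀ hτ.ne']
  · rw [eval_mul, eval_C, abs_mul, abs_of_pos (inv_pos.2 hτ)]
    exact mul_le_of_le_one_right (inv_pos.2 hτ).le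
      (abs_eval_chebyshevPolyIcc_le_one hα' d (natCast_mem_Icc.2 hk))

theorem inv_eval_chebyshevPolyIcc_le_of_mem_uniformErrors (hα : 2 ≤ Fintype.card α)
    (hnode : HasIntegerNodes (Fintype.card α) d) {c : ℝ} (hc : c ∈ uniformErrors α d) :
    ((chebyshevPolyIcc 1 (Fintype.card α) d).eval 0)⁻¹ ≤ c := by
  have hα' : (1 : ℝ) < Fintype.card α := by exact_mod_cast hα
  obtain ⟨p, hp, hp₀, hpc⟩ := mem_uniformErrors_iff.1 hc
  have hbound : ∀ i ≤ d, |p.eval (nodeIcc 1 (Fintype.card α) d i)| ≤ c := by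
    intro i hi
    obtain ⟨k, hk⟩ := hnode i hi
    have hmem := nodeIcc_mem_Icc (d := d) hα'.le i
    rw [hk] at hmem ⊢
    have hk₁ : 1 ≤ k := by exact_mod_cast hmem.1
    lift k to ℕ using by omega
    exact hpc k (natCast_mem_Icc.1 (by exact_mod_cast hmem))
  have h := eval_le_mul_eval_chebyshevPolyIcc hα' hp hbound zero_le_one
  rw [hp₀] at h
  exact (inv_le_iff_one_le_mul₀
    (zero_lt_one.trans_le (one_le_eval_chebyshevPolyIcc hα' d zero_le_one))).2 h

theorem exists_lt_inv_eval_chebyshevPolyIcc_mem_uniformErrors (hα : 2 ≤ Fintype.card α)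
    (hd : d ≠ 0) (hnode : ¬ HasIntegerNodes (Fintype.card α) d) :
    ∃ c ∈ uniformErrors α d, c < ((chebyshevPolyIcc 1 (Fintype.card α) d).eval 0)⁻¹ := by
  have hα' : (1 : ℝ) < Fintype.card α := by exact_mod_cast hα
  rw [HasIntegerNodes] at hnode
  push Not at hnode
  obtain ⟨i, hi, hik⟩ := hnode
  obtain ⟨p, hp, hp₀, hps⟩ := exists_eval_eq_one_forall_abs_eval_lt
    (s := (Finset.Icc 1 (Fintype.card α)).image (Nat.cast : ℕ → ℝ)) hα' hd
    (by
      rintro _ hy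
      obtain ⟨k, hk, rfl⟩ := Finset.mem_image.1 hy
      exact natCast_mem_Icc.2 hk)
    zero_lt_one ⟨i, hi, fun h => by
      obtain ⟨k, -, hk⟩ := Finset.mem_image.1 h
      exact hik k (by rw [← hk, Int.cast_natCast])⟩
  obtain ⟨k, hk, hmax⟩ := Finset.exists_max_image (Finset.Icc 1 (Fintype.card α))
    (fun k : ℕ => |p.eval (k : ℝ)|) (Finset.nonempty_Icc.2 (one_le_two.trans hα))
  exact ⟨_, mem_uniformErrors_iff.2 ⟨p, hp, hp₀, hmax⟩, hps _ (Finset.mem_image_of_mem _ hk)⟩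

theorem isLeast_uniformErrors_inv_eval_iff (hα : 2 ≤ Fintype.card α) (hd : d ≠ 0) :
    IsLeast (uniformErrors α d) ((chebyshevPolyIcc 1 (Fintype.card α) d).eval 0)⁻¹ ↔
      HasIntegerNodes (Fintype.card α) d := by
  constructor
  · intro h
    by_contra hnode
    obtain ⟨c, hc, hlt⟩ :=
      exists_lt_inv_eval_chebyshevPolyIcc_mem_uniformErrors hα hd hnode
    exact hlt.not_ge (h.2 hc)
  · intro hnode
    exact ⟨inv_eval_chebyshevPolyIcc_mem_uniformErrors hα,
      fun c => inv_eval_chebyshevPolyIcc_le_of_mem_uniformErrors hα hnode⟩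

end LowDegree

section Signals

open Matrix

variable {n : ℕ} (D : Prior n)

theorem target_eq_one_dotProduct : (target : Signals n → ℝ) = (1 ⬝ᵥ ·) := by
  funext x
  rw [one_dotProduct, target]

theorem measurable_observed (i : Fin n) : Measurable (observed i) :=
  measurable_pi_lambda _ fun T => measurable_pi_apply T.1

theorem info_le (i : Fin n) : info i ≤ (inferInstance : MeasurableSpace (Signals n)) :=
  (measurable_observed i).comap_le

theorem measurable_const_dotProduct (c : Finset (Fin n) → ℝ) :
    Measurable fun x : Signals n => c ⬝ᵥ x := by
  unfold dotProduct
  fun_prop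

theorem memLp_signal (T : Finset (Fin n)) : MemLp (fun x : Signals n => x T) 2 D.joint :=
  (D.memLp T).comp_measurePreserving (measurePreserving_eval (fun T => (D.law T : Measure ℝ)) T)

theorem memLp_dotProduct (c : Finset (Fin n) → ℝ) : MemLp (fun x => c ⬝ᵥ x) 2 D.joint :=
  memLp_finsetSum _ fun T _ => (memLp_signal D T).const_mul (c T)

theorem integrable_signal (T : Finset (Fin n)) :
    Integrable (fun x : Signals n => x T) D.joint :=
  (memLp_signal D T).integrable one_le_two

theorem integral_signal (T : Finset (Fin n)) : ∫ x : Signals n, x T ∂D.joint = 0 := by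
  have hmap := (measurePreserving_eval (fun T => (D.law T : Measure ℝ)) T).map_eq
  rw [← D.mean_zero T, ← hmap]
  exact (integral_map (measurable_pi_apply (X := fun _ => ℝ) T).aemeasurable
    aestronglyMeasurable_id).symm

theorem integral_dotProduct (c : Finset (Fin n) → ℝ) : ∫ x, c ⬝ᵥ x ∂D.joint = 0 := by
  simp only [dotProduct]
  rw [integral_finsetSum _ fun T _ => (integrable_signal D T).const_mul (c T)]
  simp only [integral_const_mul, integral_signal, mul_zero, Finset.sum_const_zero]

/-- The variance of the signal `X_T`, as an extended nonnegative number. -/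
def Prior.signalVar (T : Finset (Fin n)) : ENNReal :=
  evariance (fun x : ℝ => x) (D.law T : Measure ℝ)

theorem Prior.signalVar_eq_ofReal (T : Finset (Fin n)) :
    D.signalVar T = ENNReal.ofReal (variance (fun x : ℝ => x) (D.law T : Measure ℝ)) :=
  (D.memLp T).ofReal_variance_eq.symm

theorem Prior.signalVar_empty : D.signalVar ∅ = 0 := by
  rw [D.signalVar_eq_ofReal, D.law_empty, variance_dirac, ENNReal.ofReal_zero]

theorem evariance_dotProduct (c : Finset (Fin n) → ℝ) :
    evariance (fun x => c ⬝ᵥ x) D.joint =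
      ∑ T, ENNReal.ofReal (c T ^ 2) * D.signalVar T := by
  have hsum : (fun x : Signals n => c ⬝ᵥ x) = ∑ T, fun x : Signals n => c T * x T := by
    funext x
    rw [Finset.sum_apply, dotProduct]
  rw [← (memLp_dotProduct D c).ofReal_variance_eq, hsum, Prior.joint,
    variance_sum_pi (X := fun T x => c T * x) fun T => (D.memLp T).const_mul (c T),
    ENNReal.ofReal_sum_of_nonneg fun T _ => variance_nonneg _ _]
  refine Finset.sum_congr rfl fun T _ => ?_
  rw [variance_const_mul, ENNReal.ofReal_mul (sq_nonneg _), D.signalVar_eq_ofReal]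

theorem evariance_target : evariance target D.joint = ∑ T, D.signalVar T := by
  rw [target_eq_one_dotProduct, evariance_dotProduct]
  simp only [Pi.one_apply, one_pow, ENNReal.ofReal_one, one_mul]

theorem lintegral_dotProduct_sq (c : Finset (Fin n) → ℝ) :
    ∫⁻ x, ENNReal.ofReal ((c ⬝ᵥ x) ^ 2) ∂D.joint =
      ∑ T, ENNReal.ofReal (c T ^ 2) * D.signalVar T := by
  rw [← evariance_dotProduct, evariance_eq_lintegral_ofReal, integral_dotProduct]
  simp only [sub_zero]

theorem indepFun_signal_observed {i : Fin n} {T : Finset (Fin n)} (hT : i ∉ T) :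
    IndepFun (fun x : Signals n => x T) (observed i) D.joint := by
  have hindep : iIndepFun (fun T (x : Signals n) => x T) D.joint :=
    iIndepFun_pi (μ := fun T => (D.law T : Measure ℝ)) (X := fun _ x => x) fun _ => aemeasurable_id
  have hdisj : Disjoint {T} (Finset.univ.filter fun S : Finset (Fin n) => i ∈ S) := by
    rwa [Finset.disjoint_singleton_left, Finset.mem_filter_univ]
  have hfst : Measurable fun y : ({T} : Finset (Finset (Fin n))) → ℝ =>
      y ⟨T, Finset.mem_singleton_self T⟩ := by fun_prop
  have hsnd : Measurable fun (y : (Finset.univ.filter fun S : Finset (Fin n) => i ∈ S) → ℝ)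
      (S : {S : Finset (Fin n) // i ∈ S}) => y ⟨S.1, (Finset.mem_filter_univ _).2 S.2⟩ := by
    fun_prop
  exact (hindep.indepFun_finset _ _ hdisj fun T => measurable_pi_apply T).comp hfst hsnd

theorem condExp_signal (i : Fin n) (T : Finset (Fin n)) :
    D.joint[fun x : Signals n => x T | info i] =ᵐ[D.joint]
      fun x => supersetInd {i} T * x T := by
  by_cases hT : i ∈ T
  · have hmeas : Measurable[info i] fun x : Signals n => x T :=
      (measurable_pi_apply (⟨T, hT⟩ : {T : Finset (Fin n) // i ∈ T})).comp
        (comap_measurable (observed i))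
    rw [condExp_of_stronglyMeasurable (info_le i) hmeas.stronglyMeasurable
      (integrable_signal D T)]
    simp [supersetInd, hT]
  · have h := condExp_indep_eq (measurable_pi_apply T).comap_le (info_le i)
      (comap_measurable (fun x : Signals n => x T)).stronglyMeasurable
      (indepFun_signal_observed D hT)
    rw [integral_signal] at h
    simpa [supersetInd, hT] using h

theorem condExp_dotProduct (i : Fin n) (c : Finset (Fin n) → ℝ) :
    D.joint[fun x => c ⬝ᵥ x | info i] =ᵐ[D.joint] fun x => (supersetInd {i} * c) ⬝ᵥ x := by
  have hsum : (fun x : Signals n => c ⬝ᵥ x) = ∑ T, c T • fun x : Signals n => x T := by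
    funext x
    simp only [dotProduct, Finset.sum_apply, Pi.smul_apply, smul_eq_mul]
  rw [hsum]
  refine (condExp_finsetSum (fun T _ => (integrable_signal D T).smul (c T)) _).trans ?_
  filter_upwards [ae_all_iff.2 fun T => condExp_smul (c T) (fun x : Signals n => x T) (info i)
    (μ := D.joint), ae_all_iff.2 (condExp_signal D i)] with x hsmul hcond
  simp only [Finset.sum_apply, dotProduct, hsmul, Pi.smul_apply, hcond, Pi.mul_apply,
    smul_eq_mul]
  exact Finset.sum_congr rfl fun T _ => by ring

end Signals

section Elicitation

open Matrix

variable {n : ℕ}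

/-- The law of `a` times a uniformly random sign. -/
def signLaw (a : ℝ) : Measure ℝ :=
  (2⁻¹ : ENNReal) • Measure.dirac a + (2⁻¹ : ENNReal) • Measure.dirac (-a)

instance (a : ℝ) : IsProbabilityMeasure (signLaw a) :=
  ⟨by simp [signLaw, ENNReal.inv_two_add_inv_two]⟩

theorem signLaw_zero : signLaw 0 = Measure.dirac 0 := by
  rw [signLaw, neg_zero, ← add_smul, ENNReal.inv_two_add_inv_two, one_smul]

theorem signLaw_singleton_ne_zero {a x : ℝ} (hx : x = a ∨ x = -a) : signLaw a {x} ≠ 0 := by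
  rcases hx with rfl | rfl <;> simp [signLaw]

theorem integral_signLaw (a : ℝ) (f : ℝ → ℝ) : ∫ x, f x ∂signLaw a = (f a + f (-a)) / 2 := by
  have hint : ∀ b, Integrable f (Measure.dirac b) := fun b =>
    integrable_dirac enorm_lt_top
  rw [signLaw, integral_add_measure ((hint _).smul_measure (by simp))
    ((hint _).smul_measure (by simp)), integral_smul_measure, integral_smul_measure,
    integral_dirac, integral_dirac, ← smul_add, smul_eq_mul, ENNReal.toReal_inv,
    ENNReal.toReal_ofNat, inv_mul_eq_div]

theorem memLp_signLaw (a : ℝ) : MemLp (fun x : ℝ => x) 2 (signLaw a) := by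
  refine MemLp.of_bound aestronglyMeasurable_id |a| ?_
  rw [signLaw, ae_add_measure_iff]
  constructor <;>
  · refine Measure.ae_smul_measure ?_ _
    rw [ae_dirac_iff (measurableSet_le measurable_norm measurable_const)]
    simp

theorem variance_signLaw (a : ℝ) : variance (fun x : ℝ => x) (signLaw a) = a ^ 2 := by
  rw [variance_of_integral_eq_zero aemeasurable_id' (by rw [integral_signLaw]; ring),
    integral_signLaw]
  ring

/-- The prior under which the signals are the numbers `a T` with independent random signs. -/
def signPrior (a : Signals n) (ha : a ≠ 0) (ha₀ : a ∅ = 0) : Prior n where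
  law T := ⟨signLaw (a T), inferInstance⟩
  memLp T := memLp_signLaw _
  mean_zero T := by simp [integral_signLaw]
  law_empty := by simp [ha₀, signLaw_zero]
  exists_variance_pos := by
    obtain ⟨T, hT⟩ := Function.ne_iff.1 ha
    exact ⟨T, (sq_pos_of_ne_zero hT).trans_eq (variance_signLaw (a T)).symm⟩

section SignPrior

variable {a : Signals n} (ha : a ≠ 0) (ha₀ : a ∅ = 0)

theorem signalVar_signPrior (T : Finset (Fin n)) :
    (signPrior a ha ha₀).signalVar T = ENNReal.ofReal (a T ^ 2) := by
  rw [Prior.signalVar_eq_ofReal, ← variance_signLaw]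
  rfl

theorem signPrior_joint_singleton_ne_zero {x : Signals n} (hx : x = a ∨ x = -a) :
    (signPrior a ha ha₀).joint {x} ≠ 0 := by
  rw [Prior.joint, Measure.pi_singleton]
  exact Finset.prod_ne_zero_iff.2 fun T _ =>
    signLaw_singleton_ne_zero (hx.imp (congrFun · T) (congrFun · T))

theorem ae_signPrior_apply_eq_zero :
    ∀ᵐ x ∂(signPrior a ha ha₀).joint, ∀ T, a T = 0 → x T = 0 := by
  refine ae_all_iff.2 fun T => ?_
  by_cases hT : a T = 0
  · have hlaw : ∀ᵐ y ∂signLaw (a T), y = 0 := by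
      rw [hT, signLaw_zero]
      exact (ae_dirac_iff (measurableSet_singleton 0)).2 rfl
    exact ((measurePreserving_eval (fun T => ((signPrior a ha ha₀).law T : Measure ℝ))
      T).quasiMeasurePreserving.ae hlaw).mono fun _ hx _ => hx
  · exact ae_of_all _ fun _ h => absurd h hT

end SignPrior

theorem of_ae_of_singleton_ne_zero {Ω : Type*} [MeasurableSpace Ω] {μ : Measure Ω} {p : Ω → Prop}
    {x : Ω} (h : ∀ᵐ y ∂μ, p y) (hx : μ {x} ≠ 0) : p x := by
  by_contra hp
  exact hx (measure_mono_null (Set.singleton_subset_iff.2 hp) (ae_iff.1 h))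

theorem eq_of_ae_eq_of_singleton_ne_zero {Ω β : Type*} [MeasurableSpace Ω] {μ : Measure Ω}
    {f g : Ω → β} {x : Ω} (h : f =ᵐ[μ] g) (hx : μ {x} ≠ 0) : f x = g x :=
  of_ae_of_singleton_ne_zero (p := fun y => f y = g y) h hx

theorem ae_condExpKernel_comap_eq {Ω E : Type*} [MeasurableSpace Ω] [StandardBorelSpace Ω]
    [MeasurableSpace E] [MeasurableSingletonClass E] {μ : Measure Ω} [IsFiniteMeasure μ]
    {X : Ω → E} (hX : Measurable X) {x : Ω} (hx : μ {x} ≠ 0) :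
    ∀ᵐ y ∂condExpKernel μ (MeasurableSpace.comap X inferInstance) x, X y = X x := by
  have hAm : MeasurableSet[MeasurableSpace.comap X inferInstance] (X ⁻¹' {X x}) :=
    ⟨_, measurableSet_singleton _, rfl⟩
  have hA : MeasurableSet (X ⁻¹' {X x}) := hX.comap_le _ hAm
  have hcond : (condExpKernel μ (MeasurableSpace.comap X inferInstance) x).real (X ⁻¹' {X x}) =
      μ[(X ⁻¹' {X x}).indicator fun _ => (1 : ℝ) | MeasurableSpace.comap X inferInstance] x :=
    eq_of_ae_eq_of_singleton_ne_zero (condExpKernel_ae_eq_condExp hX.comap_le hA) hx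
  rw [condExp_of_stronglyMeasurable hX.comap_le (stronglyMeasurable_const.indicator hAm)
    ((integrable_const 1).indicator hA),
    Set.indicator_of_mem (show x ∈ X ⁻¹' {X x} from rfl), measureReal_def,
    ENNReal.toReal_eq_one_iff] at hcond
  exact (mem_ae_iff_prob_eq_one hA).2 hcond

theorem ae_condExpKernel_of_ae {Ω : Type*} {m mΩ : MeasurableSpace Ω} [StandardBorelSpace Ω]
    {μ : Measure Ω} [IsFiniteMeasure μ] (hm : m ≤ mΩ) {p : Ω → Prop} (h : ∀ᵐ y ∂μ, p y) {x : Ω}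
    (hx : μ {x} ≠ 0) : ∀ᵐ y ∂condExpKernel μ m x, p y := by
  rw [← condExpKernel_comp_trim (μ := μ) hm] at h
  exact of_ae_of_singleton_ne_zero (p := fun x => ∀ᵐ y ∂condExpKernel μ m x, p y)
    (ae_of_ae_trim hm (Measure.ae_ae_of_ae_comp h)) hx

/-- A realization that an expert can tell apart from every other realization of positive
probability turns the conditional expected payment into the payment itself. -/
theorem Elicitable.exists_payment {Q : Query n} {J : Type} {R : Prior n → J → Signals n → ℝ}
    (h : Elicitable Q R) : ∃ π : ℝ → (J → ℝ) → ℝ, ∀ D x, D.joint {x} ≠ 0 →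
      (∀ᵐ y ∂D.joint, observed Q.agent y = observed Q.agent x → y = x) →
      ∀ r, r ≠ Q.val D x → π r (fun j => R D j x) < π (Q.val D x) fun j => R D j x := by
  obtain ⟨π, -, hπ⟩ := h
  refine ⟨π, fun D x hx hobs r hr => ?_⟩
  have hkernel : ∀ᵐ y ∂condExpKernel D.joint (info Q.agent) x, y = x := by
    filter_upwards [ae_condExpKernel_of_ae (info_le Q.agent) hobs hx,
      ae_condExpKernel_comap_eq (measurable_observed Q.agent) hx] with y hy hyx using hy hyx
  have hint : ∀ s, ∫ y, π s (fun j => R D j y) ∂condExpKernel D.joint (info Q.agent) x =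
      π s fun j => R D j x := fun s => by
    rw [integral_congr_ae (g := fun _ => π s fun j => R D j x)
      (hkernel.mono fun y hy => by rw [hy]), integral_const, probReal_univ, one_smul]
  simpa only [hint] using (of_ae_of_singleton_ne_zero (hπ D) hx).2 r hr

-- At the realizations `a` and `-a` all references vanish, so the same payment function has the
-- unique maximizers `cQ ⬝ᵥ a` and `-(cQ ⬝ᵥ a)`.
theorem Elicitable.dotProduct_eq_zero {Q : Query n} {J : Type} [Countable J]
    {R : Prior n → J → Signals n → ℝ} (h : Elicitable Q R) {cQ : Finset (Fin n) → ℝ}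
    {c : J → Finset (Fin n) → ℝ} (hQ : ∀ D, Q.val D =ᵐ[D.joint] fun x => cQ ⬝ᵥ x)
    (hR : ∀ D j, R D j =ᵐ[D.joint] fun x => c j ⬝ᵥ x) {a : Signals n}
    (ha : supersetInd {Q.agent} * a = a) (hc : ∀ j, c j ⬝ᵥ a = 0) : cQ ⬝ᵥ a = 0 := by
  obtain ⟨π, hπ⟩ := h.exists_payment
  rcases eq_or_ne a 0 with rfl | hne
  · exact dotProduct_zero cQ
  have ha_notMem : ∀ T, Q.agent ∉ T → a T = 0 := fun T hT => by
    rw [← ha, Pi.mul_apply, supersetInd, if_neg (by simpa using hT), zero_mul]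
  let D := signPrior a hne (ha_notMem ∅ (Finset.notMem_empty _))
  have hmax : ∀ x : Signals n, x = a ∨ x = -a → ∀ r, r ≠ cQ ⬝ᵥ x →
      π r 0 < π (cQ ⬝ᵥ x) 0 := by
    intro x hxa
    have hx : D.joint {x} ≠ 0 := signPrior_joint_singleton_ne_zero _ _ hxa
    have hobs : ∀ᵐ y ∂D.joint, observed Q.agent y = observed Q.agent x → y = x := by
      filter_upwards [ae_signPrior_apply_eq_zero hne _] with y hy hyx
      funext T
      by_cases hT : Q.agent ∈ T
      · exact congrFun hyx ⟨T, hT⟩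
      · rw [hy T (ha_notMem T hT)]
        rcases hxa with rfl | rfl <;> simp [ha_notMem T hT]
    have hRx : (fun j => R D j x) = 0 := funext fun j =>
      (eq_of_ae_eq_of_singleton_ne_zero (hR D j) hx).trans
        (by rcases hxa with rfl | rfl <;> simp [hc j])
    have hQx : Q.val D x = cQ ⬝ᵥ x := eq_of_ae_eq_of_singleton_ne_zero (hQ D) hx
    simpa only [hRx, hQx] using hπ D x hx hobs
  by_contra hne₀
  have hne_neg : cQ ⬝ᵥ a ≠ cQ ⬝ᵥ -a := by
    rw [dotProduct_neg]
    exact fun h => hne₀ (self_eq_neg.1 h)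
  exact lt_asymm (hmax a (.inl rfl) _ hne_neg.symm) (hmax (-a) (.inr rfl) _ hne_neg)

theorem mem_span_range_of_forall_dotProduct_eq_zero {K ι J : Type*} [Field K] [Fintype ι]
    [Finite J] {c : J → ι → K} {b : ι → K}
    (h : ∀ a, (∀ j, c j ⬝ᵥ a = 0) → b ⬝ᵥ a = 0) : b ∈ Submodule.span K (Set.range c) := by
  classical
  have hdual : dotProductEquiv K ι b ∈
      Submodule.span K (Set.range fun j => dotProductEquiv K ι (c j)) := by
    refine mem_span_of_iInf_ker_le_ker fun a ha => h a fun j => ?_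
    exact (Submodule.mem_iInf _).1 ha j
  rw [show (fun j => dotProductEquiv K ι (c j)) = dotProductEquiv K ι ∘ c from rfl,
    Set.range_comp, ← LinearEquiv.coe_coe, Submodule.span_image] at hdual
  simpa using hdual

theorem Elicitable.mem_span {Q : Query n} {J : Type} [Finite J] {R : Prior n → J → Signals n → ℝ}
    (h : Elicitable Q R) {cQ : Finset (Fin n) → ℝ} {c : J → Finset (Fin n) → ℝ}
    (hQ : ∀ D, Q.val D =ᵐ[D.joint] fun x => cQ ⬝ᵥ x)
    (hR : ∀ D j, R D j =ᵐ[D.joint] fun x => c j ⬝ᵥ x) (hcQ : supersetInd {Q.agent} * cQ = cQ) :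
    cQ ∈ Submodule.span ℝ (Set.range fun j => supersetInd {Q.agent} * c j) := by
  have mul_dotProduct : ∀ b a : Finset (Fin n) → ℝ,
      (supersetInd {Q.agent} * b) ⬝ᵥ a = b ⬝ᵥ (supersetInd {Q.agent} * a) := fun b a =>
    Finset.sum_congr rfl fun T _ => by simp only [Pi.mul_apply]; ring
  refine mem_span_range_of_forall_dotProduct_eq_zero fun a ha => ?_
  rw [← hcQ, mul_dotProduct]
  refine h.dotProduct_eq_zero hQ hR ?_ fun j => (mul_dotProduct (c j) a).symm.trans (ha j)
  rw [← mul_assoc, supersetInd_mul, Finset.union_self]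

end Elicitation

section Order

open Matrix

variable {n m : ℕ} {G : Digraph (Option (Fin m))} {Q : Fin m → Query n}

theorem order_le_iff {k : Fin m} {l : ℕ} :
    order G k ≤ l ↔ ∀ l', HasWalk G (some k) none l' → l' ≤ l := by
  simp only [order, iSup₂_le_iff, Nat.cast_le]

theorem exists_dagElicits_order_le {d : ℕ} (h : orderComplexity Q ≤ d) :
    ∃ G, DAGElicits G Q ∧ ∀ k, order G k ≤ d := by
  have hlt : orderComplexity Q < d + 1 := h.trans_lt (by exact_mod_cast d.lt_succ_self)
  simp only [orderComplexity, iInf_lt_iff] at hlt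
  obtain ⟨G, hG, hGd⟩ := hlt
  exact ⟨G, hG, fun k => (le_iSup _ k).trans (Order.le_of_lt_add_one hGd)⟩

theorem DAGElicits.wellFounded (hG : DAGElicits G Q) : WellFounded fun v w => G.Adj w v := by
  have : IsTrans (Option (Fin m)) fun v w => Relation.TransGen G.Adj w v :=
    ⟨fun _ _ _ hab hbc => hbc.trans hab⟩
  have : Std.Irrefl fun v w : Option (Fin m) => Relation.TransGen G.Adj w v := ⟨hG.acyclic⟩
  exact Subrelation.wf (fun h => Relation.TransGen.single h)
    (Finite.wellFounded_of_trans_of_irrefl fun v w => Relation.TransGen G.Adj w v)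

theorem DAGElicits.exists_adj (hG : DAGElicits G Q) (k : Fin m) : ∃ w, G.Adj (some k) w := by
  simpa using mt (hG.sink_iff (some k)).1 (Option.some_ne_none k)

theorem DAGElicits.exists_hasWalk (hG : DAGElicits G Q) (v : Option (Fin m)) :
    ∃ l, HasWalk G v none l := by
  induction v using hG.wellFounded.induction with
  | _ v ih =>
    cases v with
    | none => exact ⟨0, .nil none⟩
    | some k =>
      obtain ⟨w, hw⟩ := hG.exists_adj k
      obtain ⟨l, hl⟩ := ih w hw
      exact ⟨l + 1, .cons hw hl⟩

theorem DAGElicits.not_order_le_zero (hG : DAGElicits G Q) (k : Fin m) :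
    ¬ order G k ≤ (0 : ℕ) := by
  obtain ⟨w, hw⟩ := hG.exists_adj k
  obtain ⟨l, hl⟩ := hG.exists_hasWalk w
  exact fun h => l.not_succ_le_zero (order_le_iff.1 h _ (.cons hw hl))

theorem order_le_of_adj {k k' : Fin m} {l : ℕ} (h : G.Adj (some k) (some k'))
    (hk : order G k ≤ (l + 1 : ℕ)) : order G k' ≤ l :=
  order_le_iff.2 fun _ hw => Nat.le_of_succ_le_succ (order_le_iff.1 hk _ (.cons h hw))

-- A query is a combination of its conditional references by elicitability alone, so that the
-- graph need not be one along which the queries are iterated linear conditional expectations.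
theorem DAGElicits.mem_lowDegree (hG : DAGElicits G Q)
    {c : Option (Fin m) → Finset (Fin n) → ℝ} (hc_none : c none = 1)
    (hc : ∀ D v, vertexVal Q D v =ᵐ[D.joint] fun x => c v ⬝ᵥ x)
    (hagent : ∀ k, supersetInd {(Q k).agent} * c (some k) = c (some k)) {l : ℕ} {k : Fin m}
    (hk : order G k ≤ l) : c (some k) ∈ lowDegree (Fin n) l := by
  induction l generalizing k with
  | zero => exact absurd hk (hG.not_order_le_zero k)
  | succ l ih =>
    have hspan := (hG.elicitable k).mem_span (c := fun v => c v) (fun D => hc D (some k))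
      (fun D v => hc D v) (hagent k)
    refine Submodule.span_le.2 ?_ hspan
    rintro _ ⟨⟨v, hv⟩, rfl⟩
    cases v with
    | none =>
      dsimp only
      rw [hc_none, mul_one]
      exact supersetInd_mem_lowDegree (Finset.singleton_nonempty _) (by simp)
    | some k' =>
      have h := supersetInd_mul_mem_lowDegree {(Q k).agent} (ih (order_le_of_adj hv hk))
      rwa [Finset.card_singleton, add_comm] at h

open Classical in
theorem AggRule.IsLinear.exists_coeff {R : AggRule n} (h : R.IsLinear) :
    ∃ c : Option (Fin R.size) → Finset (Fin n) → ℝ, c none = 1 ∧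
      (∀ D v, vertexVal R.query D v =ᵐ[D.joint] fun x => c v ⬝ᵥ x) ∧
      ∀ k, supersetInd {(R.query k).agent} * c (some k) = c (some k) := by
  obtain ⟨⟨G, hG, α, hα⟩, -⟩ := h
  have exists_coeff : ∀ v : Option (Fin R.size), ∃ c : Finset (Fin n) → ℝ,
      (∀ D, vertexVal R.query D v =ᵐ[D.joint] fun x => c ⬝ᵥ x) ∧ (v = none → c = 1) ∧
      ∀ k, v = some k → supersetInd {(R.query k).agent} * c = c := by
    intro v
    induction v using hG.wellFounded.induction with
    | _ v ih =>
      cases v with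
      | none =>
        exact ⟨1, fun D => .of_eq target_eq_one_dotProduct, fun _ => rfl, nofun⟩
      | some k =>
        choose! c hc using ih
        refine ⟨supersetInd {(R.query k).agent} * ∑ v with G.Adj (some k) v, α k v • c v,
          fun D => (hα D k).trans ((condExp_congr_ae ?_).trans (condExp_dotProduct D _ _)),
          nofun, ?_⟩
        · have hrep : ∀ᵐ x ∂D.joint, ∀ v, G.Adj (some k) v →
              vertexVal R.query D v x = c v ⬝ᵥ x :=
            ae_all_iff.2 fun v => Filter.eventually_imp_distrib_left.2 fun hv => (hc v hv).1 D
          filter_upwards [hrep] with x hx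
          rw [sum_dotProduct]
          refine Finset.sum_congr rfl fun v hv => ?_
          rw [smul_dotProduct, hx v (Finset.mem_filter.1 hv).2, smul_eq_mul]
        · rintro _ ⟨⟩
          rw [← mul_assoc, supersetInd_mul, Finset.union_self]
  choose c hc hc_none hagent using exists_coeff
  exact ⟨c, hc_none none rfl, fun D v => hc v D, fun k => hagent (some k) k rfl⟩

theorem AggRule.IsLinear.exists_output_eq {R : AggRule n} (h : R.IsLinear) {d : ℕ}
    (hd : orderComplexity R.query ≤ d) :
    ∃ f ∈ lowDegree (Fin n) d, ∀ D, R.output D =ᵐ[D.joint] fun x => f ⬝ᵥ x := by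
  obtain ⟨c, hc_none, hc, hagent⟩ := h.exists_coeff
  obtain ⟨G, hG, hGd⟩ := exists_dagElicits_order_le hd
  obtain ⟨-, β, hβ⟩ := h
  refine ⟨∑ k, β k • c (some k), Submodule.sum_mem _ fun k _ => Submodule.smul_mem _ _
    (hG.mem_lowDegree hc_none hc hagent (hGd k)), fun D => ?_⟩
  filter_upwards [ae_all_iff.2 fun k => hc D (some k)] with x hx
  rw [AggRule.output, hβ, sum_dotProduct]
  refine Finset.sum_congr rfl fun k _ => ?_
  rw [smul_dotProduct, ← hx k, smul_eq_mul, vertexVal]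

end Order

section Construction

open Matrix

variable {n d : ℕ}

theorem elicitable_of_ae_eq_condExp {Q : Query n} {J : Type} {R : Prior n → J → Signals n → ℝ}
    (j : J) (hR : ∀ D, Integrable (R D j) D.joint)
    (hQ : ∀ D, Q.val D =ᵐ[D.joint] D.joint[R D j | info Q.agent]) : Elicitable Q R := by
  refine ⟨fun r y => 2 * r * y j - r ^ 2, fun r => by fun_prop, fun D => ?_⟩
  filter_upwards [(hR D).condExpKernel_ae (m := info Q.agent), hQ D,
    condExp_ae_eq_integral_condExpKernel (info_le Q.agent) (hR D)] with x hint hx hx'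
  have payment_eq : ∀ r : ℝ,
      ∫ y, 2 * r * R D j y - r ^ 2 ∂condExpKernel D.joint (info Q.agent) x =
        Q.val D x ^ 2 - (r - Q.val D x) ^ 2 := fun r => by
    rw [integral_sub (hint.const_mul _) (integrable_const _), integral_const_mul, ← hx', ← hx,
      integral_const, probReal_univ, one_smul]
    ring
  refine ⟨fun r => (hint.const_mul _).sub (integrable_const _), fun r hr => ?_⟩
  rw [payment_eq, payment_eq, sub_self]
  linarith [sq_pos_of_ne_zero (sub_ne_zero.2 hr)]

/-- The query that asks the smallest member of `S` for the sum of the signals `X_T`, `S ⊆ T`. -/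
def supersetQuery (S : Finset (Fin n)) (hS : S.Nonempty) : Query n where
  agent := S.min' hS
  answer _ y := ∑ T : {T : Finset (Fin n) // S.min' hS ∈ T}, supersetInd S T * y T
  measurable_answer _ := by fun_prop

theorem supersetQuery_val (S : Finset (Fin n)) (hS : S.Nonempty) (D : Prior n) :
    (supersetQuery S hS).val D = fun x => supersetInd S ⬝ᵥ x := by
  funext x
  have hfilter : ∑ T with S.min' hS ∈ T, supersetInd S T * x T = supersetInd S ⬝ᵥ x :=
    Finset.sum_filter_of_ne fun T _ hT => by
      by_contra hmem
      exact hT (by rw [supersetInd, if_neg fun h => hmem (h (S.min'_mem hS)), zero_mul])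
  rw [← hfilter, Finset.sum_subtype _ fun T => Finset.mem_filter_univ T]
  rfl

theorem supersetQuery_val_ae_eq_condExp (S : Finset (Fin n)) (hS : S.Nonempty) (D : Prior n) :
    (supersetQuery S hS).val D =ᵐ[D.joint]
      D.joint[fun x => supersetInd (S.erase (S.min' hS)) ⬝ᵥ x | info (S.min' hS)] := by
  have h := condExp_dotProduct D (S.min' hS) (supersetInd (S.erase (S.min' hS)))
  rw [supersetInd_mul, Finset.singleton_union, Finset.insert_erase (S.min'_mem hS)] at h
  rw [supersetQuery_val]
  exact h.symm

section Graph

variable (n d)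

/-- The nonempty sets of at most `d` experts. -/
abbrev SmallSet : Type := {S : Finset (Fin n) // S.Nonempty ∧ S.card ≤ d}

/-- An enumeration of the nonempty sets of at most `d` experts. -/
def smallSet (k : Fin (Fintype.card (SmallSet n d))) : SmallSet n d :=
  (Fintype.equivFin (SmallSet n d)).symm k

/-- The superset queries of all nonempty sets of at most `d` experts. -/
def supersetQueries (k : Fin (Fintype.card (SmallSet n d))) : Query n :=
  supersetQuery (smallSet n d k).1 (smallSet n d k).2.1

/-- The set of experts that belongs to a vertex of the elicitation graph of the superset queries.
The target `Y` is the sum of the `X_T` with `∅ ⊆ T` and belongs to the empty set. -/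
def vertexSet : Option (Fin (Fintype.card (SmallSet n d))) → Finset (Fin n)
  | none => ∅
  | some k => (smallSet n d k).1

/-- The graph in which the query of `S` refers to that of `S` without its smallest member. -/
def supersetGraph : Digraph (Option (Fin (Fintype.card (SmallSet n d)))) where
  Adj v w := ∃ hv : (vertexSet n d v).Nonempty,
    vertexSet n d w = (vertexSet n d v).erase ((vertexSet n d v).min' hv)

end Graph

variable {k : Fin (Fintype.card (SmallSet n d))}
  {v w : Option (Fin (Fintype.card (SmallSet n d)))}

theorem vertexSet_eq_empty_iff : vertexSet n d v = ∅ ↔ v = none := by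
  cases v with
  | none => exact iff_of_true rfl rfl
  | some k => exact iff_of_false (smallSet n d k).2.1.ne_empty (Option.some_ne_none k)

theorem card_vertexSet_le (v : Option (Fin (Fintype.card (SmallSet n d)))) :
    (vertexSet n d v).card ≤ d := by
  cases v with
  | none => exact Nat.zero_le d
  | some k => exact (smallSet n d k).2.2

theorem vertexSet_injective : Function.Injective (vertexSet n d) := by
  rintro (_ | k) (_ | l) h
  · rfl
  · exact (vertexSet_eq_empty_iff.1 h.symm).symm
  · exact vertexSet_eq_empty_iff.1 h
  · rw [(Fintype.equivFin (SmallSet n d)).symm.injective (Subtype.ext h)]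

theorem exists_vertexSet_eq {S : Finset (Fin n)} (hS : S.card ≤ d) :
    ∃ v, vertexSet n d v = S := by
  rcases S.eq_empty_or_nonempty with rfl | hne
  · exact ⟨none, rfl⟩
  · refine ⟨some (Fintype.equivFin (SmallSet n d) ⟨S, hne, hS⟩), ?_⟩
    rw [vertexSet, smallSet, Equiv.symm_apply_apply]

theorem vertexVal_supersetQueries (D : Prior n)
    (v : Option (Fin (Fintype.card (SmallSet n d)))) :
    vertexVal (supersetQueries n d) D v = fun x => supersetInd (vertexSet n d v) ⬝ᵥ x := by
  cases v with
  | none => rw [vertexVal, target_eq_one_dotProduct, vertexSet, supersetInd_empty]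
  | some k => exact supersetQuery_val _ _ D

theorem vertexSet_ssubset_of_adj (h : (supersetGraph n d).Adj v w) :
    vertexSet n d w ⊂ vertexSet n d v := by
  obtain ⟨hv, hw⟩ := h
  rw [hw]
  exact Finset.erase_ssubset (Finset.min'_mem _ _)

theorem vertexSet_ssubset_of_transGen (h : Relation.TransGen (supersetGraph n d).Adj v w) :
    vertexSet n d w ⊂ vertexSet n d v := by
  induction h with
  | single h => exact vertexSet_ssubset_of_adj h
  | tail _ h ih => exact (vertexSet_ssubset_of_adj h).trans ih

theorem exists_supersetGraph_adj (k : Fin (Fintype.card (SmallSet n d))) :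
    ∃ w, (supersetGraph n d).Adj (some k) w := by
  obtain ⟨w, hw⟩ := exists_vertexSet_eq
    ((Finset.card_erase_le (a := (smallSet n d k).1.min' (smallSet n d k).2.1)).trans
      (smallSet n d k).2.2)
  exact ⟨w, (smallSet n d k).2.1, hw⟩

theorem supersetQueries_val_ae_eq_condExp (h : (supersetGraph n d).Adj (some k) w)
    (D : Prior n) : (supersetQueries n d k).val D =ᵐ[D.joint]
      D.joint[vertexVal (supersetQueries n d) D w | info (supersetQueries n d k).agent] := by
  obtain ⟨hk, hw⟩ := h
  rw [vertexVal_supersetQueries, hw]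
  exact supersetQuery_val_ae_eq_condExp _ hk D

theorem dagElicits_supersetGraph : DAGElicits (supersetGraph n d) (supersetQueries n d) where
  acyclic v hv := (vertexSet_ssubset_of_transGen hv).ne rfl
  sink_iff v := by
    constructor
    · cases v with
      | none => exact fun _ => rfl
      | some k => exact fun h => absurd (exists_supersetGraph_adj k) (not_exists.2 h)
    · rintro rfl w ⟨hne, -⟩
      exact hne.ne_empty rfl
  elicitable k := by
    obtain ⟨w, hw⟩ := exists_supersetGraph_adj k
    refine elicitable_of_ae_eq_condExp ⟨w, hw⟩ (fun D => ?_)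
      (supersetQueries_val_ae_eq_condExp hw)
    rw [vertexVal_supersetQueries]
    exact (memLp_dotProduct D _).integrable one_le_two

theorem add_card_vertexSet_le_of_hasWalk {l : ℕ} (h : HasWalk (supersetGraph n d) v w l) :
    l + (vertexSet n d w).card ≤ (vertexSet n d v).card := by
  induction h with
  | nil => exact (zero_add _).le
  | cons h _ ih =>
    have := Finset.card_lt_card (vertexSet_ssubset_of_adj h)
    omega

theorem orderComplexity_supersetQueries_le : orderComplexity (supersetQueries n d) ≤ d := by
  refine iInf₂_le_of_le _ dagElicits_supersetGraph (iSup_le fun k => order_le_iff.2 fun l hl => ?_)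
  exact (Nat.le_add_right _ _).trans
    ((add_card_vertexSet_le_of_hasWalk hl).trans (card_vertexSet_le _))

theorem relevantAgents_supersetGraph_subset (k : Fin (Fintype.card (SmallSet n d))) :
    relevantAgents (supersetQueries n d) (supersetGraph n d) k ⊆ (smallSet n d k).1 := by
  rintro _ ⟨j, hj, rfl⟩
  have hsub : vertexSet n d (some j) ⊆ vertexSet n d (some k) := by
    rcases Relation.reflTransGen_iff_eq_or_transGen.1 hj with h | h
    · rw [h]
    · exact (vertexSet_ssubset_of_transGen h).subset
  exact hsub (Finset.min'_mem _ (smallSet n d j).2.1)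

theorem agentComplexity_supersetQueries_le : agentComplexity (supersetQueries n d) ≤ d := by
  refine iInf₂_le_of_le _ dagElicits_supersetGraph (iSup_le fun k => ?_)
  refine (Set.encard_le_encard (relevantAgents_supersetGraph_subset k)).trans ?_
  rw [Set.encard_coe_eq_coe_finsetCard]
  exact_mod_cast (smallSet n d k).2.2

/-- The rule that asks all superset queries and combines the answers with the given
coefficients. -/
def supersetRule (b : Fin (Fintype.card (SmallSet n d)) → ℝ) : AggRule n where
  size := Fintype.card (SmallSet n d)
  query := supersetQueries n d
  agg a := ∑ k, b k * a k

theorem supersetRule_isLinear (b : Fin (Fintype.card (SmallSet n d)) → ℝ) :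
    (supersetRule b).IsLinear := by
  classical
  refine ⟨⟨supersetGraph n d, dagElicits_supersetGraph, fun _ _ => 1,
    fun D (k : Fin (Fintype.card (SmallSet n d))) => ?_⟩, b, fun _ => rfl⟩
  obtain ⟨w, hw⟩ := exists_supersetGraph_adj k
  have hsum : (fun x => ∑ v with (supersetGraph n d).Adj (some k) v,
      (1 : ℝ) * vertexVal (supersetQueries n d) D v x) = vertexVal (supersetQueries n d) D w := by
    have hfilter : Finset.univ.filter ((supersetGraph n d).Adj (some k)) = {w} := by
      refine Finset.eq_singleton_iff_unique_mem.2 ⟨(Finset.mem_filter_univ w).2 hw, fun v hv => ?_⟩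
      obtain ⟨_, hv⟩ := (Finset.mem_filter_univ v).1 hv
      exact vertexSet_injective (hv.trans hw.2.symm)
    funext x
    rw [hfilter, Finset.sum_singleton, one_mul]
  have h := supersetQueries_val_ae_eq_condExp hw D
  rwa [← hsum] at h

theorem lowDegree_eq_span_range :
    lowDegree (Fin n) d = Submodule.span ℝ (Set.range
      fun k : Fin (Fintype.card (SmallSet n d)) => supersetInd (smallSet n d k).1) := by
  rw [lowDegree]
  congr 1
  ext g
  constructor
  · rintro ⟨S, hS, rfl⟩
    exact ⟨Fintype.equivFin (SmallSet n d) ⟨S, hS⟩, by simp only [smallSet, Equiv.symm_apply_apply]⟩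
  · rintro ⟨k, rfl⟩
    exact ⟨_, (smallSet n d k).2, rfl⟩

theorem exists_supersetRule_output_eq {f : Finset (Fin n) → ℝ} (hf : f ∈ lowDegree (Fin n) d) :
    ∃ b : Fin (Fintype.card (SmallSet n d)) → ℝ,
      ∀ D, (supersetRule b).output D = fun x => f ⬝ᵥ x := by
  rw [lowDegree_eq_span_range, Submodule.mem_span_range_iff_exists_fun] at hf
  obtain ⟨b, rfl⟩ := hf
  refine ⟨b, fun D => funext fun x => ?_⟩
  change ∑ k, b k * (supersetQueries n d k).val D x = _
  rw [sum_dotProduct]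
  refine Finset.sum_congr rfl fun k _ => ?_
  rw [smul_dotProduct, smul_eq_mul]
  exact congrArg (b k * ·) (congrFun (supersetQuery_val _ _ D) x)

end Construction

section Approximators

open Matrix

variable {n d : ℕ}

/-- The prior under which only the signal of `S` is random. -/
def singlePrior (S : Finset (Fin n)) (hS : S.Nonempty) : Prior n :=
  signPrior (Pi.single S 1) (Pi.single_ne_zero_iff.2 one_ne_zero)
    (Pi.single_eq_of_ne hS.ne_empty.symm 1)

theorem signalVar_singlePrior (S : Finset (Fin n)) (hS : S.Nonempty) (T : Finset (Fin n)) :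
    (singlePrior S hS).signalVar T = if T = S then 1 else 0 := by
  rw [singlePrior, signalVar_signPrior, Pi.single_apply]
  split_ifs <;> simp

section Weights

variable {A : Approximator n} {e : Finset (Fin n) → ENNReal}
  (he : ∀ D, A.loss D = ∑ T, e T * D.signalVar T)

include he

theorem relLoss_singlePrior (S : Finset (Fin n)) (hS : S.Nonempty) :
    A.relLoss (singlePrior S hS) = e S := by
  rw [Approximator.relLoss, he, evariance_target]
  simp [signalVar_singlePrior]

theorem relLoss_le {c : ENNReal} (hc : ∀ T, T.Nonempty → e T ≤ c) (D : Prior n) :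
    A.relLoss D ≤ c := by
  refine ENNReal.div_le_of_le_mul ?_
  rw [he, evariance_target, Finset.mul_sum]
  refine Finset.sum_le_sum fun T _ => ?_
  rcases T.eq_empty_or_nonempty with rfl | hT
  · rw [D.signalVar_empty, mul_zero, mul_zero]
  · exact mul_le_mul_left (hc T hT) _

theorem weight_le_error {T : Finset (Fin n)} (hT : T.Nonempty) : e T ≤ A.error :=
  (relLoss_singlePrior he T hT).symm.trans_le (le_iSup A.relLoss _)

theorem isGreatest_relLoss_of_loss_eq_sum [NeZero n] :
    IsGreatest (Set.range A.relLoss) A.error := by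
  have : Nonempty {T : Finset (Fin n) // T.Nonempty} := ⟨⟨_, Finset.univ_nonempty⟩⟩
  obtain ⟨⟨S, hS⟩, hmax⟩ :=
    Finite.exists_max fun T : {T : Finset (Fin n) // T.Nonempty} => e T
  have herror : A.error = e S :=
    le_antisymm (iSup_le (relLoss_le he fun T hT => hmax ⟨T, hT⟩)) (weight_le_error he hS)
  exact ⟨⟨_, (relLoss_singlePrior he S hS).trans herror.symm⟩,
    Set.forall_mem_range.2 (le_iSup A.relLoss)⟩

end Weights

section Coefficients

variable {A : Approximator n} {f : A.Context → Finset (Fin n) → ℝ}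
  (hf : ∀ D, ∀ᵐ z ∂A.P, A.val D z =ᵐ[D.joint] fun x => f z ⬝ᵥ x)

include hf

theorem loss_eq_lintegral (D : Prior n) :
    A.loss D = ∫⁻ z, ∑ T, ENNReal.ofReal ((f z T - 1) ^ 2) * D.signalVar T ∂A.P := by
  have htarget : Measurable (target : Signals n → ℝ) := by
    rw [target_eq_one_dotProduct]
    exact measurable_const_dotProduct 1
  have herr : AEMeasurable (fun p : A.Context × Signals n =>
      ENNReal.ofReal ((A.val D p.1 p.2 - target p.2) ^ 2)) (A.P.prod D.joint) :=
    (((A.aemeasurable_val D).sub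
      (htarget.comp measurable_snd).aemeasurable).pow_const 2).ennreal_ofReal
  rw [Approximator.loss, lintegral_prod _ herr]
  refine lintegral_congr_ae ((hf D).mono fun z hz => ?_)
  refine Eq.trans (lintegral_congr_ae (hz.mono fun x hx => ?_))
    (lintegral_dotProduct_sq D (f z - 1))
  beta_reduce
  rw [hx, target_eq_one_dotProduct, sub_dotProduct]

-- Under the single-signal prior the value at the atom `X_T = 1` is the coefficient of `X_T`.
theorem aemeasurable_coeff {T : Finset (Fin n)} (hT : T.Nonempty) :
    AEMeasurable (fun z => f z T) A.P := by
  let D := singlePrior T hT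
  have hatom : D.joint {(Pi.single T 1 : Signals n)} ≠ 0 :=
    signPrior_joint_singleton_ne_zero _ _ (.inl rfl)
  have hval := A.aemeasurable_val D
  refine ⟨fun z => hval.mk _ (z, Pi.single T 1),
    hval.measurable_mk.comp measurable_prodMk_right, ?_⟩
  filter_upwards [hf D, Measure.ae_ae_of_ae_prod hval.ae_eq_mk] with z hz hmk
  rw [← of_ae_of_singleton_ne_zero hmk hatom, eq_of_ae_eq_of_singleton_ne_zero hz hatom,
    dotProduct_single_one]

theorem loss_eq_sum (D : Prior n) :
    A.loss D = ∑ T, (∫⁻ z, ENNReal.ofReal ((f z T - 1) ^ 2) ∂A.P) * D.signalVar T := by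
  have hterm : ∀ T, AEMeasurable (fun z => ENNReal.ofReal ((f z T - 1) ^ 2) * D.signalVar T) A.P :=
    fun T => by
      rcases T.eq_empty_or_nonempty with rfl | hT
      · simp only [D.signalVar_empty, mul_zero, aemeasurable_const]
      · exact ((((aemeasurable_coeff hf hT).sub_const 1).pow_const 2).ennreal_ofReal).mul_const _
  rw [loss_eq_lintegral hf, lintegral_finsetSum' _ fun T _ => hterm T]
  refine Finset.sum_congr rfl fun T _ => lintegral_mul_const' _ _ ?_
  rw [D.signalVar_eq_ofReal]
  exact ENNReal.ofReal_ne_top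

end Coefficients

theorem exists_coeff_of_mem_linApproximators {A : Approximator n}
    (hA : A ∈ linApproximators n d) : ∃ f : A.Context → Finset (Fin n) → ℝ,
      (∀ᵐ z ∂A.P, f z ∈ lowDegree (Fin n) d) ∧
      ∀ D, ∀ᵐ z ∂A.P, A.val D z =ᵐ[D.joint] fun x => f z ⬝ᵥ x := by
  obtain ⟨R, himpl, hR⟩ := hA
  obtain ⟨f, hf⟩ := Filter.skolem.1
    (hR.mono fun z hz => hz.1.exists_output_eq hz.2.2)
  refine ⟨f, hf.mono fun z hz => hz.1, fun D => ?_⟩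
  filter_upwards [hf, Measure.ae_ae_of_ae_prod (himpl D)] with z hz hval
  exact Filter.EventuallyEq.trans hval (hz.2 D)

theorem isGreatest_relLoss [NeZero n] {A : Approximator n} (hA : A ∈ linApproximators n d) :
    IsGreatest (Set.range A.relLoss) A.error := by
  obtain ⟨f, -, hf⟩ := exists_coeff_of_mem_linApproximators hA
  exact isGreatest_relLoss_of_loss_eq_sum (loss_eq_sum hf)

section Jensen

variable {Ω : Type*} [MeasurableSpace Ω] {P : Measure Ω} {g : Ω → ℝ}

theorem lintegral_ofReal_sq_eq_eLpNorm_sq :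
    ∫⁻ z, ENNReal.ofReal (g z ^ 2) ∂P = eLpNorm g 2 P ^ 2 := by
  have h := eLpNorm_nnreal_pow_eq_lintegral (p := 2) (μ := P) (f := g) two_ne_zero
  norm_num at h
  rw [h]
  refine lintegral_congr fun z => ?_
  rw [Real.enorm_eq_ofReal_abs, ← ENNReal.ofReal_pow (abs_nonneg _), sq_abs]

variable [IsProbabilityMeasure P] {a : ℝ}

theorem integrable_of_lintegral_sq_sub_const_ne_top (hg : AEMeasurable g P)
    (hfin : ∫⁻ z, ENNReal.ofReal ((g z - a) ^ 2) ∂P ≠ ⊤) : Integrable g P := by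
  rw [lintegral_ofReal_sq_eq_eLpNorm_sq] at hfin
  have hLp : MemLp (fun z => g z - a) 2 P :=
    ⟨(hg.sub_const a).aestronglyMeasurable,
      lt_top_iff_ne_top.2 fun h => hfin (by rw [h, ENNReal.top_pow two_ne_zero])⟩
  exact (integrable_add_iff_integrable_left (integrable_const (-a))).1
    (hLp.integrable one_le_two)

theorem ofReal_sq_integral_sub_const_le_lintegral (hg : Integrable g P) :
    ENNReal.ofReal ((∫ z, g z ∂P - a) ^ 2) ≤ ∫⁻ z, ENNReal.ofReal ((g z - a) ^ 2) ∂P := by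
  have hsub : Integrable (fun z => g z - a) P := hg.sub (integrable_const a)
  have hmean : ∫ z, g z ∂P - a = ∫ z, (g z - a) ∂P := by
    rw [integral_sub hg (integrable_const a), integral_const, probReal_univ, one_smul]
  rw [lintegral_ofReal_sq_eq_eLpNorm_sq, hmean, ← sq_abs, ENNReal.ofReal_pow (abs_nonneg _),
    ← Real.enorm_eq_ofReal_abs]
  refine pow_le_pow_left₀ zero_le ?_ 2
  calc ‖∫ z, (g z - a) ∂P‖ₑ ≤ eLpNorm (fun z => g z - a) 1 P := by
        rw [eLpNorm_one_eq_lintegral_enorm]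
        exact enorm_integral_le_lintegral_enorm _
    _ ≤ eLpNorm (fun z => g z - a) 2 P :=
        eLpNorm_le_eLpNorm_of_exponent_le one_le_two hsub.aestronglyMeasurable

end Jensen

theorem ofReal_sq_le_error {δ : ℝ} (hδ : IsLeast (uniformErrors (Fin n) d) δ) (hδ₀ : 0 ≤ δ)
    {A : Approximator n} (hA : A ∈ linApproximators n d) : ENNReal.ofReal (δ ^ 2) ≤ A.error := by
  obtain ⟨f, hmem, hf⟩ := exists_coeff_of_mem_linApproximators hA
  rcases eq_or_ne A.error ⊤ with htop | htop
  · exact htop ▸ le_top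
  have hweight := fun (T : Finset (Fin n)) (hT : T.Nonempty) =>
    weight_le_error (loss_eq_sum hf) hT
  have hint : Integrable f A.P := Integrable.of_eval fun T => by
    rcases T.eq_empty_or_nonempty with rfl | hT
    · exact (integrable_zero _ ℝ A.P).congr
        (hmem.mono fun z hz => (apply_empty_of_mem_lowDegree hz).symm)
    · exact integrable_of_lintegral_sq_sub_const_ne_top (aemeasurable_coeff hf hT)
        (ne_top_of_le_ne_top htop (hweight T hT))
  have hmean : ∫ z, f z ∂A.P ∈ lowDegree (Fin n) d :=
    (lowDegree (Fin n) d).convex.integral_mem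
      (lowDegree (Fin n) d).closed_of_finiteDimensional hmem hint
  have hle : δ ≤ √A.error.toReal := hδ.2 ⟨_, hmean, fun T hT => by
    rw [eval_integral hint.eval]
    refine Real.abs_le_sqrt ((ENNReal.ofReal_le_iff_le_toReal htop).1 ?_)
    exact (ofReal_sq_integral_sub_const_le_lintegral (hint.eval T)).trans (hweight T hT)⟩
  exact ENNReal.ofReal_le_of_le_toReal ((Real.le_sqrt hδ₀ ENNReal.toReal_nonneg).1 hle)

/-- The deterministic approximator with the coefficients `f`. -/
def linApproximator (f : Finset (Fin n) → ℝ) : Approximator n where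
  Context := Unit
  P := Measure.dirac ()
  val _ _ x := f ⬝ᵥ x
  aemeasurable_val _ := ((measurable_const_dotProduct f).comp measurable_snd).aemeasurable

theorem linApproximator_mem {f : Finset (Fin n) → ℝ} (hf : f ∈ lowDegree (Fin n) d) :
    linApproximator f ∈ linApproximators n d := by
  obtain ⟨b, hb⟩ := exists_supersetRule_output_eq hf
  exact ⟨fun _ => supersetRule b, fun D => ae_of_all _ fun p => (congrFun (hb D) p.2).symm,
    ae_of_all _ fun _ => ⟨supersetRule_isLinear b, agentComplexity_supersetQueries_le,
      orderComplexity_supersetQueries_le⟩⟩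

theorem loss_linApproximator (f : Finset (Fin n) → ℝ) (D : Prior n) :
    (linApproximator f).loss D = ∑ T, ENNReal.ofReal ((f T - 1) ^ 2) * D.signalVar T := by
  rw [loss_eq_lintegral (A := linApproximator f) (f := fun _ => f)
    (fun D => ae_of_all _ fun _ => ae_eq_rfl), lintegral_const, measure_univ, mul_one]

theorem isLeast_error {δ : ℝ} (hδ : IsLeast (uniformErrors (Fin n) d) δ) (hδ₀ : 0 ≤ δ) :
    IsLeast (Approximator.error '' linApproximators n d) (ENNReal.ofReal (δ ^ 2)) := by
  obtain ⟨f, hf, hfδ⟩ := hδ.1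
  have hmem := linApproximator_mem hf
  refine ⟨⟨linApproximator f, hmem, le_antisymm (iSup_le ?_) (ofReal_sq_le_error hδ hδ₀ hmem)⟩,
    Set.forall_mem_image.2 fun A hA => ofReal_sq_le_error hδ hδ₀ hA⟩
  exact relLoss_le (loss_linApproximator f) fun T hT =>
    ENNReal.ofReal_le_ofReal (sq_le_sq.2 ((hfδ T hT).trans (le_abs_self δ)))

theorem isLeast_error_iff (hn : 2 ≤ n) (hd : d ≠ 0) :
    IsLeast (Approximator.error '' linApproximators n d)
        (ENNReal.ofReal (4 / (q n ^ (d : ℤ) + q n ^ (-(d : ℤ))) ^ 2)) ↔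
      HasIntegerNodes n d := by
  have : NeZero n := ⟨by omega⟩
  obtain ⟨δ, hδ⟩ := exists_isLeast_uniformErrors (Fin n) d
  have hδ₀ : 0 ≤ δ := nonneg_of_mem_uniformErrors hδ.1
  have hvalue : 4 / (q n ^ (d : ℤ) + q n ^ (-(d : ℤ))) ^ 2 =
      ((chebyshevPolyIcc 1 n d).eval 0)⁻¹ ^ 2 := by
    rw [inv_eval_chebyshevPolyIcc_zero hn, div_pow]
    norm_num
  have hpos : 0 ≤ ((chebyshevPolyIcc 1 n d).eval 0)⁻¹ := inv_nonneg.2 (zero_le_one.trans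
    (one_le_eval_chebyshevPolyIcc (by exact_mod_cast hn) d zero_le_one))
  have hcheb := isLeast_uniformErrors_inv_eval_iff (α := Fin n) (by rwa [Fintype.card_fin]) hd
  rw [Fintype.card_fin] at hcheb
  rw [hvalue, ← hcheb]
  refine ⟨fun h => ?_, fun h => isLeast_error h hpos⟩
  have hsq := (ENNReal.ofReal_eq_ofReal_iff (sq_nonneg _) (sq_nonneg _)).1
    ((isLeast_error hδ hδ₀).unique h)
  rwa [(pow_left_inj₀ hδ₀ hpos two_ne_zero).1 hsq] at hδ

end Approximators

end PartialInfo

end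

theorem mainTheorem6 (n d : ℕ) (hn : 2 ≤ n) (hd : 1 ≤ d) :
    -- the maximum that defines the worst-case error of an approximator is attained,
    (∀ A ∈ PartialInfo.linApproximators n d, IsGreatest (Set.range A.relLoss) A.error) ∧
    -- and so is the minimum of the worst-case errors;
    (∃ e, IsLeast (PartialInfo.Approximator.error '' PartialInfo.linApproximators n d) e) ∧
    -- the minimum has the stated value exactly in the listed cases,
    (IsLeast (PartialInfo.Approximator.error '' PartialInfo.linApproximators n d)
        (ENNReal.ofReal
          (4 / (PartialInfo.q n ^ (d : ℤ) + PartialInfo.q n ^ (-(d : ℤ))) ^ 2)) ↔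
      d = 1 ∨ (d = 2 ∧ Odd n) ∨ (d = 3 ∧ n ≡ 1 [MOD 4])) ∧
    -- and exactly if the extremal points of the shifted Chebyshev polynomial are integers.
    (IsLeast (PartialInfo.Approximator.error '' PartialInfo.linApproximators n d)
        (ENNReal.ofReal
          (4 / (PartialInfo.q n ^ (d : ℤ) + PartialInfo.q n ^ (-(d : ℤ))) ^ 2)) ↔
      ∀ x ∈ Set.Icc (1 : ℝ) n,
        IsMaxOn (fun y => |PartialInfo.shiftedChebyshev n d y|) (Set.Icc (1 : ℝ) n) x →
          ∃ k : ℤ, x = k) := by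
  have : NeZero n := ⟨by omega⟩
  obtain ⟨δ, hδ⟩ := PartialInfo.exists_isLeast_uniformErrors (Fin n) d
  have hδ₀ : 0 ≤ δ := PartialInfo.nonneg_of_mem_uniformErrors hδ.1
  have hiff := PartialInfo.isLeast_error_iff hn (Nat.one_le_iff_ne_zero.1 hd)
  refine ⟨fun A hA => PartialInfo.isGreatest_relLoss hA, ⟨_, PartialInfo.isLeast_error hδ hδ₀⟩,
    ?_, ?_⟩
  · rw [hiff, PartialInfo.hasIntegerNodes_iff hn hd]
  · rw [hiff, PartialInfo.forall_isMaxOn_isInt_iff hn (Nat.one_le_iff_ne_zero.1 hd)]
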